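/- Notation. A distribution on $[k]=\{1,\dots,k\}$ is a probability vector in $\mathbb R^k$; a channel $T$ from $[k]$ to a countable set $\mathcal Y$ is a column-stochastic matrix $(T(y,x))_{y\in\mathcal Y,x\in[k]}$, and $Tp$ is the law of its output when the input has law $p$. It is $\varepsilon$-LDP if $T(y,x)\le e^{\varepsilon}T(y,x')$ for all $x,x',y$. Let $H^2=H^2(p,q)=\sum_i(\sqrt{p_i}-\sqrt{q_i})^2$. For a set $\mathcal C$ of channels, the sample complexity of testing $p$ against $q$ under $\mathcal C$ is the smallest $n$ for which there are $T_1,\dots,T_n\in\mathcal C$ and a deterministic test of $(Y_1,\dots,Y_n)$, with $Y_i=T_i(X_i)$ independent and $X_1,\dots,X_n$ i.i.d. from $p$ or from $q$, whose two error probabilities sum to at most $0.1$. Write $n^*(p,q)$ when $\mathcal C$ is the set of all channels $[k]\to\mathbb N$, $n^*(p,q,\varepsilon)$ when it is the set of all $\varepsilon$-LDP channels $[k]\to\mathbb N$, and $N_T(p,q)$ when $\mathcal C=\{T\}$. The $m$-ary randomized response $R^{\varepsilon}_m$ is the channel $[m]\to[m]$ that keeps its input with probability $\frac{e^\varepsilon}{m-1+e^\varepsilon}$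 and outputs each other symbol with probability $\frac1{m-1+e^\varepsilon}$. Algorithms run on a real RAM (unit cost for $+,-,\times,/,\sqrt{\ },\exp,\log$ and comparisons of reals, and for $+,-$ and comparisons of integers; no rounding of reals) with input $(k,p,q,\varepsilon)$; logarithms are natural. Theorem. (1) There is one algorithm such that for every $c>0$ there is a constant $C$ (depending only on $c$) with the following property. Let $k\in\mathbb N$, let $p\ne q$ be distributions on $[k]$ and let $\varepsilon>1$ satisfy $e^{\varepsilon}\ge c\cdot\frac1{H^2}\log\frac1{H^2}$. Then $n^*(p,q)$ is finite and $$n^*(p,q)\le n^*(p,q,\varepsilon)\le C\,n^*(p,q).$$ Moreover, with $\ell=\max(2,\lceil\log n^*(p,q)\rceil)$, there are $m$ with $2\le m\le\ell$ and a deterministic map (quantizer) $Q:[k]\to[m]$ with $H^2(p,q)\le C\,H^2(Qp,Qq)$, such that $T=R^{\varepsilon}_m Q$, regarded as a channel from $[k]$ to $[\ell]\supseteq[m]$, is an $\varepsilon$-LDP channel with $n^*(p,q,\varepsilon)\le N_T(p,q)\le C\,n^*(p,q)$; the algorithm outputs $m$ and the matrix $R^{\varepsilon}_mQ$ in time at most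 $a\,(k+\log n^*(p,q))^d$, where $a,d$ are universal constants. (2) There are an algorithm and universal constants $a,d$ and $c_0>0$ such that, for all $k$, all distributions $p\neq q$ on $[k]$ and all $\varepsilon>1$, the algorithm outputs in time at most $a(k+\ell)^d$ the matrix of an $\varepsilon$-LDP channel $T$ from $[k]$ to $[\ell]$, where $\ell=\max\bigl(2,\min(\lceil\log(1/H^2)\rceil_+,k)\bigr)$ and $\lceil x\rceil_+=\max(0,\lceil x\rceil)$, such that, with $L=\max(1,\log(1/H^2))$, $$H^2(Tp,Tq)\ \ge\ c_0\,H^2\cdot\min\Bigl(1,\frac{e^{\varepsilon}H^2}{L}\Bigr)\cdot\min\Bigl(1,\frac{e^{\varepsilon}}{L}\Bigr).$$ -/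

import Mathlib

open scoped Matrix

/-! ## Channels, local privacy and divergences

A distribution on `[k]` is a vector in `stdSimplex ℝ (Fin k)`. A channel from a finite domain `X` to a
countable domain `Y` is a column-stochastic matrix `T : Matrix Y X ℝ`, where `T y x` is the probability of
the output `y` on the input `x`; the output law of `p` is `T *ᵥ p`. -/

/-- Column-stochastic matrices: nonnegative entries, every column sums to one. -/
def IsChannel {X Y : Type} (T : Matrix Y X ℝ) : Prop :=
  (∀ y x, 0 ≤ T y x) ∧ ∀ x, HasSum (fun y => T y x) 1

/-- `ε`-local differential privacy of a channel into a countable domain. -/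
def IsLDP {X Y : Type} (ε : ℝ) (T : Matrix Y X ℝ) : Prop :=
  ∀ x x' y, T y x ≤ Real.exp ε * T y x'

/-- Hellinger divergence `∑ i, (√p i - √q i)²`. -/
noncomputable def hellingerSq {X : Type} [Fintype X] (p q : X → ℝ) : ℝ :=
  ∑ i, (√(p i) - √(q i)) ^ 2

/-- The deterministic channel (quantizer) given by a map. -/
def detChannel {X Y : Type} [DecidableEq Y] (f : X → Y) : Matrix Y X ℝ :=
  Matrix.of fun y x => if f x = y then 1 else 0

/-- The `m`-ary randomized response channel with privacy parameter `ε`. -/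
noncomputable def randResponse (ε : ℝ) (m : ℕ) : Matrix (Fin m) (Fin m) ℝ :=
  Matrix.of fun y x =>
    if y = x then Real.exp ε / ((m - 1 : ℝ) + Real.exp ε) else 1 / ((m - 1 : ℝ) + Real.exp ε)

/-! ## Simple binary hypothesis testing under channel constraints -/

/-- Probability that `(Y₁, …, Yₙ)` lies in `A` when the `Y i` are independent with laws `P i`. -/
noncomputable def productProb {Y : Type} {n : ℕ} (P : Fin n → Y → ℝ) (A : Set (Fin n → Y)) : ℝ :=
  ∑' y : Fin n → Y, A.indicator (fun y => ∏ i, P i (y i)) y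

/-- The product of probability vectors is a probability vector, so that the sums in `productProb`
converge. -/
theorem hasSum_prod_mass {Y : Type} {n : ℕ} (P : Fin n → Y → ℝ) (h0 : ∀ i y, 0 ≤ P i y)
    (h1 : ∀ i, HasSum (P i) 1) : HasSum (fun y : Fin n → Y => ∏ i, P i (y i)) 1 := by
  induction n with
  | zero => simp
  | succ n ih =>
    have h2 := ih (fun i => P i.succ) (fun i y => h0 _ y) (fun i => h1 _)
    have hs : Summable fun x : Y × (Fin n → Y) => P 0 x.1 * ∏ i, P (Fin.succ i) (x.2 i) :=
      Summable.mul_of_nonneg (f := P 0) (g := fun y : Fin n → Y => ∏ i, P (Fin.succ i) (y i))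
        (h1 0).summable h2.summable (fun y => h0 0 y)
        (fun y => Finset.prod_nonneg fun i _ => h0 _ _)
    have h3 := (h1 0).mul h2 hs
    rw [← (Fin.consEquiv (fun _ : Fin (n + 1) => Y)).hasSum_iff]
    simpa [Function.comp_def, Fin.prod_univ_succ, Fin.consEquiv] using h3

/-- With `n` users, user `i` applying a channel `R i` from the class `𝒞` to an independent sample, some
test `φ` (the value `true` stands for the guess `p`, `false` for `q`) has sum of its two error
probabilities at most `0.1`. -/
def SolvableWith {X Y : Type} [Fintype X] (𝒞 : Set (Matrix Y X ℝ)) (p q : X → ℝ) (n : ℕ) : Prop :=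
  ∃ R : Fin n → Matrix Y X ℝ, (∀ i, R i ∈ 𝒞) ∧ ∃ φ : (Fin n → Y) → Bool,
    productProb (fun i => R i *ᵥ p) {y | φ y = false} +
      productProb (fun i => R i *ᵥ q) {y | φ y = true} ≤ 0.1

/-- Sample complexity under the channel constraint `𝒞`: the smallest number of users that suffices
(`⊤` if there is none). -/
noncomputable def sampleComplexity {X Y : Type} [Fintype X] (𝒞 : Set (Matrix Y X ℝ))
    (p q : X → ℝ) : ℕ∞ :=
  sInf ((fun n : ℕ => (n : ℕ∞)) '' {n | SolvableWith 𝒞 p q n})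

/-- `n*(p, q)`: arbitrary channels into `ℕ`. -/
noncomputable def nStar {k : ℕ} (p q : Fin k → ℝ) : ℕ∞ :=
  sampleComplexity {T : Matrix ℕ (Fin k) ℝ | IsChannel T} p q

/-- `n*(p, q, ε)`: `ε`-LDP channels into `ℕ`. -/
noncomputable def nStarLDP {k : ℕ} (p q : Fin k → ℝ) (ε : ℝ) : ℕ∞ :=
  sampleComplexity {T : Matrix ℕ (Fin k) ℝ | IsChannel T ∧ IsLDP ε T} p q

/-! ## Real RAM

A uniform machine model for exact real input: while-programs over integer registers and random access
real arrays. There is no rounding of reals to integers and no multiplication of integers. A program is a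
fixed finite text, and every executed assignment or test counts as one step. -/

/-- Memory: integer registers, and two-dimensional real arrays `real a i j` (array `a`, row `i`,
column `j`). -/
structure RAMState where
  nat : ℕ → ℕ
  real : ℕ → ℕ → ℕ → ℝ

inductive NatExpr where
  | const (n : ℕ)
  | reg (r : ℕ)
  | add (e₁ e₂ : NatExpr)
  | sub (e₁ e₂ : NatExpr)

def NatExpr.eval (s : RAMState) : NatExpr → ℕ
  | .const n => n
  | .reg r => s.nat r
  | .add e₁ e₂ => e₁.eval s + e₂.eval s
  | .sub e₁ e₂ => e₁.eval s - e₂.eval s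

inductive RealExpr where
  | ofNat (e : NatExpr)
  | cell (a : ℕ) (i j : NatExpr)
  | add (e₁ e₂ : RealExpr)
  | sub (e₁ e₂ : RealExpr)
  | mul (e₁ e₂ : RealExpr)
  | div (e₁ e₂ : RealExpr)
  | sqrt (e : RealExpr)
  | exp (e : RealExpr)
  | log (e : RealExpr)

noncomputable def RealExpr.eval (s : RAMState) : RealExpr → ℝ
  | .ofNat e => (e.eval s : ℝ)
  | .cell a i j => s.real a (i.eval s) (j.eval s)
  | .add e₁ e₂ => e₁.eval s + e₂.eval s
  | .sub e₁ e₂ => e₁.eval s - e₂.eval s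
  | .mul e₁ e₂ => e₁.eval s * e₂.eval s
  | .div e₁ e₂ => e₁.eval s / e₂.eval s
  | .sqrt e => √(e.eval s)
  | .exp e => Real.exp (e.eval s)
  | .log e => Real.log (e.eval s)

inductive RAMTest where
  | natLt (e₁ e₂ : NatExpr)
  | realLt (e₁ e₂ : RealExpr)
  | neg (b : RAMTest)
  | both (b₁ b₂ : RAMTest)

def RAMTest.Holds (s : RAMState) : RAMTest → Prop
  | .natLt e₁ e₂ => e₁.eval s < e₂.eval s
  | .realLt e₁ e₂ => e₁.eval s < e₂.eval s
  | .neg b => ¬ b.Holds s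
  | .both b₁ b₂ => b₁.Holds s ∧ b₂.Holds s

inductive RAMProgram where
  | setNat (r : ℕ) (e : NatExpr)
  | setReal (a : ℕ) (i j : NatExpr) (e : RealExpr)
  | seq (c₁ c₂ : RAMProgram)
  | ite (b : RAMTest) (c₁ c₂ : RAMProgram)
  | loop (b : RAMTest) (c : RAMProgram)

def RAMState.setNat (s : RAMState) (r v : ℕ) : RAMState where
  nat := Function.update s.nat r v
  real := s.real

def RAMState.setReal (s : RAMState) (a i j : ℕ) (v : ℝ) : RAMState where
  nat := s.nat
  real := fun a' i' j' => if a' = a ∧ i' = i ∧ j' = j then v else s.real a' i' j'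

/-- `RAMRuns c s t s'`: the program `c`, started in memory `s`, halts after `t` steps in memory `s'`.
`loop b c` repeats `c` while `b` holds. -/
inductive RAMRuns : RAMProgram → RAMState → ℕ → RAMState → Prop where
  | setNat (r e s) : RAMRuns (.setNat r e) s 1 (s.setNat r (e.eval s))
  | setReal (a i j e s) :
      RAMRuns (.setReal a i j e) s 1 (s.setReal a (i.eval s) (j.eval s) (e.eval s))
  | seq {c₁ c₂ s s₁ s₂ t₁ t₂} : RAMRuns c₁ s t₁ s₁ → RAMRuns c₂ s₁ t₂ s₂ →
      RAMRuns (.seq c₁ c₂) s (t₁ + t₂) s₂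
  | iteTrue {b c₁ c₂ s s' t} : b.Holds s → RAMRuns c₁ s t s' → RAMRuns (.ite b c₁ c₂) s (t + 1) s'
  | iteFalse {b c₁ c₂ s s' t} : ¬ b.Holds s → RAMRuns c₂ s t s' →
      RAMRuns (.ite b c₁ c₂) s (t + 1) s'
  | loopDone {b c s} : ¬ b.Holds s → RAMRuns (.loop b c) s 1 s
  | loopStep {b c s s₁ s₂ t₁ t₂} : b.Holds s → RAMRuns c s t₁ s₁ → RAMRuns (.loop b c) s₁ t₂ s₂ →
      RAMRuns (.loop b c) s (t₁ + t₂ + 1) s₂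

/-- Input convention: register `0` holds `k`, row `0` of the arrays `0` and `1` holds `p` and `q`, cell
`(0, 0)` of array `2` holds `ε`; the rest of the memory is zero. -/
noncomputable def ramInput {k : ℕ} (p q : Fin k → ℝ) (ε : ℝ) : RAMState where
  nat := fun r => if r = 0 then k else 0
  real := fun a i j =>
    if a = 0 ∧ i = 0 then (if h : j < k then p ⟨j, h⟩ else 0)
    else if a = 1 ∧ i = 0 then (if h : j < k then q ⟨j, h⟩ else 0)
    else if a = 2 ∧ i = 0 ∧ j = 0 then ε
    else 0

/-- On input `(p, q, ε)` the program halts after exactly `t` steps and has written the number `m` into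
register `1` and the `m × k` matrix `M` into array `3`. -/
def RAMOutputs (c : RAMProgram) {k : ℕ} (p q : Fin k → ℝ) (ε : ℝ) (t : ℕ) {m : ℕ}
    (M : Matrix (Fin m) (Fin k) ℝ) : Prop :=
  ∃ s, RAMRuns c (ramInput p q ε) t s ∧ s.nat 1 = m ∧
    ∀ (r : Fin m) (x : Fin k), s.real 3 r x = M r x

/-! ## Output sizes -/

/-- `⌈log n*(p, q)⌉`, but at least `2`. -/
noncomputable def freeSize {k : ℕ} (p q : Fin k → ℝ) : ℕ :=
  max 2 ⌈Real.log ((nStar p q).toNat : ℝ)⌉₊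

/-- `min(⌈log(1 / h²)⌉, k)`, but at least `2`. -/
noncomputable def quantSize {k : ℕ} (p q : Fin k → ℝ) : ℕ :=
  max 2 (min ⌈Real.log (1 / hellingerSq p q)⌉₊ k)

/-- `log(1 / h²)`, but at least `1`. -/
noncomputable def logInvHellinger {k : ℕ} (p q : Fin k → ℝ) : ℝ :=
  max 1 (Real.log (1 / hellingerSq p q))

/-! ## Hellinger divergence: elementary estimates -/

/-! Sample complexity is governed by the Hellinger divergence. Whatever the channels, `n` users can
succeed only if `n * H² ≥ 1` (`one_le_mul_hellingerSq`), while `5 / H²(Tp, Tq)` users suffice with a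
fixed finite-output channel `T` (`solvableWith_singleton`). Hence everything reduces to computing an
LDP channel that loses little Hellinger divergence. The same channel, randomized response after a
quantizer, and the same program serve both parts.

The quantizer uses that `(√a - √b)²` equals `δ² (a + b)` up to a factor 2, where `δ = |a - b| / (a +
b)`. One of the two sides `p > q`, `p < q` carries at least half of `H²`. On that side the symbols
are binned by `δ` on the geometric scale `exp (-4 j)`. Inside a bin all differences have the same
sign and, outside the last bin, comparable `δ`, so merging costs only a constant. The last bin
collects everything else: symbols of the chosen side that fall there have such small `δ` that they
carry at most a quarter of `H²` once there are `log (1 / H²)` bins (`hellingerSq_le_of_bins`). If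
that many bins would be at least `k`, no merging is needed.

Randomized response on `m` symbols mixes the law with the uniform one. Symbols of mass below `g /
(2m)`, with `g` the divergence of the quantized laws, carry at most half of `g`; on the others the
loss is explicit (`hellingerSq_randResponse`). As `m` is at most `2L`, this yields the two minima of
part (2), and in the low-privacy regime both are bounded below (`le_min_mul_min_of_low_privacy`),
which yields part (1). -/

theorem sq_mul_add_le_of_mul_le_abs_sub {a b t : ℝ} (ha : 0 ≤ a) (hb : 0 ≤ b) (ht : 0 ≤ t)
    (h : t * (a + b) ≤ |a - b|) : t ^ 2 * (a + b) ≤ 2 * (√a - √b) ^ 2 := by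
  obtain ⟨u, hu, rfl⟩ : ∃ u, 0 ≤ u ∧ a = u ^ 2 := ⟨√a, Real.sqrt_nonneg _, (Real.sq_sqrt ha).symm⟩
  obtain ⟨v, hv, rfl⟩ : ∃ v, 0 ≤ v ∧ b = v ^ 2 := ⟨√b, Real.sqrt_nonneg _, (Real.sq_sqrt hb).symm⟩
  rw [Real.sqrt_sq hu, Real.sqrt_sq hv]
  have h1 : (t * (u ^ 2 + v ^ 2)) ^ 2 ≤ (u ^ 2 - v ^ 2) ^ 2 := by
    rw [← sq_abs (u ^ 2 - v ^ 2)]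
    gcongr
  rcases (show 0 ≤ u ^ 2 + v ^ 2 by positivity).eq_or_lt with h0 | h0
  · rw [← h0, mul_zero]
    positivity
  · refine le_of_mul_le_mul_right ?_ h0
    nlinarith [mul_nonneg (sq_nonneg (u - v)) (sq_nonneg (u - v))]

/-- With `a = u²` and `b = v²`, this and the preceding converse both rest on `|a - b| = |u - v| (u +
v)` and `u² + v² ≤ (u + v)² ≤ 2 (u² + v²)`. They exchange Hellinger terms for relative differences.
-/
theorem sqrt_sub_sqrt_sq_le_of_abs_sub_le {a b t : ℝ} (ha : 0 ≤ a) (hb : 0 ≤ b)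
    (h : |a - b| ≤ t * (a + b)) : (√a - √b) ^ 2 ≤ t ^ 2 * (a + b) := by
  obtain ⟨u, hu, rfl⟩ : ∃ u, 0 ≤ u ∧ a = u ^ 2 := ⟨√a, Real.sqrt_nonneg _, (Real.sq_sqrt ha).symm⟩
  obtain ⟨v, hv, rfl⟩ : ∃ v, 0 ≤ v ∧ b = v ^ 2 := ⟨√b, Real.sqrt_nonneg _, (Real.sq_sqrt hb).symm⟩
  rw [Real.sqrt_sq hu, Real.sqrt_sq hv]
  have h1 : (u ^ 2 - v ^ 2) ^ 2 ≤ (t * (u ^ 2 + v ^ 2)) ^ 2 := by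
    rw [← sq_abs (u ^ 2 - v ^ 2)]
    gcongr
  rcases (show 0 ≤ (u + v) ^ 2 by positivity).eq_or_lt with h0 | h0
  · have : u + v = 0 := by simpa using h0.symm
    obtain rfl : u = 0 := by linarith
    obtain rfl : v = 0 := by linarith
    simp
  · refine le_of_mul_le_mul_right ?_ h0
    have : t ^ 2 * (u ^ 2 + v ^ 2) * (u ^ 2 + v ^ 2) ≤ t ^ 2 * (u ^ 2 + v ^ 2) * (u + v) ^ 2 := by
      gcongr
      nlinarith [mul_nonneg hu hv]
    nlinarith

theorem sqrt_sub_sqrt_sq_le_add {a b : ℝ} (ha : 0 ≤ a) (hb : 0 ≤ b) :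
    (√a - √b) ^ 2 ≤ a + b := by
  nlinarith [Real.sq_sqrt ha, Real.sq_sqrt hb, mul_nonneg (Real.sqrt_nonneg a) (Real.sqrt_nonneg b)]

section

variable {X : Type} [Fintype X] {p q : X → ℝ}

theorem hellingerSq_nonneg (p q : X → ℝ) : 0 ≤ hellingerSq p q :=
  Finset.sum_nonneg fun _ _ => sq_nonneg _

theorem hellingerSq_pos (hp : p ∈ stdSimplex ℝ X) (hq : q ∈ stdSimplex ℝ X) (hpq : p ≠ q) :
    0 < hellingerSq p q := by
  obtain ⟨x, hx⟩ := Function.ne_iff.1 hpq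
  refine Finset.sum_pos' (fun _ _ => sq_nonneg _) ⟨x, Finset.mem_univ _, ?_⟩
  have : √(p x) - √(q x) ≠ 0 := by
    rw [sub_ne_zero]
    exact fun h => hx ((Real.sqrt_inj (hp.1 x) (hq.1 x)).1 h)
  positivity

/-- The Bhattacharyya coefficient in terms of the Hellinger divergence. -/
theorem sum_sqrt_mul_sqrt (hp : p ∈ stdSimplex ℝ X) (hq : q ∈ stdSimplex ℝ X) :
    ∑ x, √(p x) * √(q x) = 1 - hellingerSq p q / 2 := by
  have : hellingerSq p q = ∑ x, (p x + q x - 2 * (√(p x) * √(q x))) := by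
    refine Finset.sum_congr rfl fun x _ => ?_
    nlinarith [Real.sq_sqrt (hp.1 x), Real.sq_sqrt (hq.1 x)]
  rw [this, Finset.sum_sub_distrib, Finset.sum_add_distrib, hp.2, hq.2, ← Finset.mul_sum]
  ring

theorem hellingerSq_le_two (hp : p ∈ stdSimplex ℝ X) (hq : q ∈ stdSimplex ℝ X) :
    hellingerSq p q ≤ 2 := by
  have := sum_sqrt_mul_sqrt hp hq
  have : 0 ≤ ∑ x, √(p x) * √(q x) := Finset.sum_nonneg fun _ _ => by positivity
  linarith

end

/-! ## Deterministic channels -/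

theorem mul_detChannel_apply {X Y Z : Type} [Fintype Y] [DecidableEq Y] (R : Matrix Z Y ℝ)
    (Q : X → Y) (z : Z) (x : X) : (R * detChannel Q) z x = R z (Q x) := by
  simp [Matrix.mul_apply, detChannel]

theorem isChannel_mul_detChannel {X Y Z : Type} [Fintype Y] [DecidableEq Y] {R : Matrix Z Y ℝ}
    (hR : IsChannel R) (Q : X → Y) : IsChannel (R * detChannel Q) := by
  simp only [IsChannel, mul_detChannel_apply]
  exact ⟨fun y x => hR.1 y _, fun x => hR.2 _⟩

theorem isLDP_mul_detChannel {X Y Z : Type} [Fintype Y] [DecidableEq Y] {R : Matrix Z Y ℝ}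
    {ε : ℝ} (hR : IsLDP ε R) (Q : X → Y) : IsLDP ε (R * detChannel Q) := by
  simp only [IsLDP, mul_detChannel_apply]
  exact fun x x' y => hR _ _ _

section

variable {X Y : Type} [Fintype X] [DecidableEq Y]

theorem detChannel_mulVec (Q : X → Y) (p : X → ℝ) (y : Y) :
    (detChannel Q *ᵥ p) y = ∑ x with Q x = y, p x := by
  simp [Matrix.mulVec, dotProduct, detChannel, Finset.sum_filter]

theorem detChannel_mulVec_mem_stdSimplex [Fintype Y] (Q : X → Y) {p : X → ℝ}
    (hp : p ∈ stdSimplex ℝ X) : detChannel Q *ᵥ p ∈ stdSimplex ℝ Y := by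
  refine ⟨fun y => ?_, ?_⟩
  · rw [detChannel_mulVec]
    exact Finset.sum_nonneg fun x _ => hp.1 x
  · simp only [detChannel_mulVec]
    rw [Finset.sum_fiberwise, hp.2]

end

/-- Binning by the sign-adjusted relative difference, with geometric thresholds, preserves the
Hellinger divergence up to a constant. -/
theorem hellingerSq_le_of_bins {k m : ℕ} {p q : Fin k → ℝ} (hp : p ∈ stdSimplex ℝ (Fin k))
    (hq : q ∈ stdSimplex ℝ (Fin k)) (hpq : p ≠ q) (hm : 2 ≤ m)
    (hlog : Real.log (1 / hellingerSq p q) ≤ m) {σ : ℝ} (hσ : |σ| = 1)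
    (hS : 0 ≤ σ * ∑ x, (√(p x) - √(q x)) * |√(p x) - √(q x)|) (Q : Fin k → Fin m)
    (h₁ : ∀ x, ∀ i < (Q x : ℕ), σ * (p x - q x) ≤ Real.exp (-(4 * (i + 1))) * (p x + q x))
    (h₂ : ∀ x, (Q x : ℕ) + 1 < m →
      Real.exp (-(4 * ((Q x : ℕ) + 1))) * (p x + q x) < σ * (p x - q x)) :
    hellingerSq p q ≤ 8 * Real.exp 8 * hellingerSq (detChannel Q *ᵥ p) (detChannel Q *ᵥ q) := by
  have hpos := hellingerSq_pos hp hq hpq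
  have hσabs (a : ℝ) : |a| = |σ * a| := by rw [abs_mul, hσ, one_mul]
  -- Hellinger terms of the symbols outside the last bin; `τ` is the smallest threshold, below which
  -- a symbol of sign `σ` lands in the last bin.
  set v : Fin k → ℝ := fun x => if (Q x : ℕ) + 1 < m then (√(p x) - √(q x)) ^ 2 else 0 with hv
  set τ : ℝ := Real.exp (-(4 * (m - 1))) with hτ
  -- The left side is twice the Hellinger term if `p x - q x` has sign `σ` and zero otherwise; by
  -- `hS` its sum is at least `H²`.
  have hpoint (x : Fin k) : (√(p x) - √(q x)) ^ 2 + σ * ((√(p x) - √(q x)) * |√(p x) - √(q x)|) ≤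
      2 * v x + 2 * (τ ^ 2 * (p x + q x)) := by
    have hp0 := hp.1 x
    have hq0 := hq.1 x
    have hres : 0 ≤ τ ^ 2 * (p x + q x) := by positivity
    have hv0 : 0 ≤ v x := by simp only [hv]; split_ifs <;> positivity
    have habs : |σ * ((√(p x) - √(q x)) * |√(p x) - √(q x)|)| = (√(p x) - √(q x)) ^ 2 := by
      rw [← hσabs, abs_mul, abs_abs, ← pow_two, sq_abs]
    by_cases hs : σ * (p x - q x) ≤ 0
    · have : σ * ((√(p x) - √(q x)) * |√(p x) - √(q x)|) ≤ 0 := by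
        have e : p x - q x = (√(p x) - √(q x)) * (√(p x) + √(q x)) := by
          nlinarith [Real.sq_sqrt hp0, Real.sq_sqrt hq0]
        have h0 : 0 ≤ √(p x) + √(q x) := by positivity
        rcases h0.eq_or_lt with h0 | h0
        · have a1 := Real.sqrt_nonneg (p x)
          have a2 := Real.sqrt_nonneg (q x)
          have : √(p x) - √(q x) = 0 := by linarith
          simp [this]
        · have : σ * (√(p x) - √(q x)) ≤ 0 := by
            rw [e, ← mul_assoc] at hs
            exact nonpos_of_mul_nonpos_left hs h0
          rw [← mul_assoc]
          exact mul_nonpos_of_nonpos_of_nonneg this (abs_nonneg _)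
      rw [abs_of_nonpos this] at habs
      linarith
    · have hle := le_abs_self (σ * ((√(p x) - √(q x)) * |√(p x) - √(q x)|))
      rw [habs] at hle
      by_cases hb : (Q x : ℕ) + 1 < m
      · simp only [hv, if_pos hb] at hv0 ⊢
        linarith
      · have hQ := (Q x).2
        have hQe : ((m - 2 : ℕ) : ℝ) + 1 = m - 1 := by
          rw [Nat.cast_sub hm]
          push_cast
          ring
        have h := h₁ x (m - 2) (by omega)
        rw [hQe] at h
        have h' : |p x - q x| ≤ τ * (p x + q x) := by
          rw [hσabs, abs_of_pos (not_le.1 hs)]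
          exact h
        have := sqrt_sub_sqrt_sq_le_of_abs_sub_le hp0 hq0 h'
        linarith
  have hsum := Finset.sum_le_sum fun x (_ : x ∈ Finset.univ) => hpoint x
  rw [Finset.sum_add_distrib, ← Finset.mul_sum, Finset.sum_add_distrib, ← Finset.mul_sum,
    ← Finset.mul_sum, ← Finset.mul_sum, Finset.sum_add_distrib, hp.2, hq.2] at hsum
  -- For `m ≥ 2` one has `8 (m - 1) ≥ m + 4`: the `m` pays for `H²`, the `4` for the factor `8`.
  have hτ2 : 8 * τ ^ 2 ≤ hellingerSq p q := by
    have hm' : (2 : ℝ) ≤ m := by exact_mod_cast hm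
    have e1 : τ ^ 2 ≤ Real.exp (-4) * Real.exp (-m) := by
      rw [hτ, ← Real.exp_nat_mul, ← Real.exp_add]
      apply Real.exp_le_exp.2
      push_cast
      linarith
    have e2 : Real.exp (-m) ≤ hellingerSq p q := by
      rw [← Real.exp_log hpos]
      apply Real.exp_le_exp.2
      rw [one_div, Real.log_inv] at hlog
      linarith
    have e3 : Real.exp (-4) ≤ 1 / 8 := by
      rw [Real.exp_neg, one_div]
      apply inv_anti₀ (by norm_num)
      have := Real.add_one_le_exp (1 : ℝ)
      have e : Real.exp 4 = Real.exp 1 ^ 4 := by rw [← Real.exp_nat_mul]; norm_num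
      rw [e]
      calc (8 : ℝ) ≤ 2 ^ 4 := by norm_num
        _ ≤ _ := by gcongr; linarith
    have := mul_le_mul e3 e2 (Real.exp_nonneg _) (by norm_num)
    linarith
  have hbins : ∑ x, v x ≤
      2 * Real.exp 8 * hellingerSq (detChannel Q *ᵥ p) (detChannel Q *ᵥ q) := by
    rw [← Finset.sum_fiberwise Finset.univ Q v, hellingerSq, Finset.mul_sum]
    refine Finset.sum_le_sum fun y _ => ?_
    rw [detChannel_mulVec, detChannel_mulVec]
    set P := ∑ x with Q x = y, p x
    set P' := ∑ x with Q x = y, q x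
    have hP : 0 ≤ P := Finset.sum_nonneg fun x _ => hp.1 x
    have hP' : 0 ≤ P' := Finset.sum_nonneg fun x _ => hq.1 x
    by_cases hy : (y : ℕ) + 1 < m
    · set t : ℝ := Real.exp (-(4 * ((y : ℕ) + 1))) with ht
      -- All differences in the bin have sign `σ`, so they add up without cancellation.
      have key : t * (P + P') ≤ |P - P'| := by
        rw [hσabs]
        refine le_trans ?_ (le_abs_self _)
        rw [← Finset.sum_add_distrib, ← Finset.sum_sub_distrib, Finset.mul_sum, Finset.mul_sum]
        refine Finset.sum_le_sum fun x hx => ?_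
        obtain rfl := (Finset.mem_filter.1 hx).2
        exact (h₂ x hy).le
      have h3 := sq_mul_add_le_of_mul_le_abs_sub hP hP' (Real.exp_nonneg _) key
      have h4 : ∑ x with Q x = y, v x ≤ Real.exp 8 * t ^ 2 * (P + P') := by
        rw [← Finset.sum_add_distrib, Finset.mul_sum]
        refine Finset.sum_le_sum fun x hx => ?_
        obtain rfl := (Finset.mem_filter.1 hx).2
        simp only [hv, if_pos hy]
        have hx0 : 0 ≤ p x + q x := add_nonneg (hp.1 x) (hq.1 x)
        have hspos : 0 ≤ σ * (p x - q x) := by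
          have := h₂ x hy
          have : 0 ≤ Real.exp (-(4 * ((Q x : ℕ) + 1))) * (p x + q x) := by positivity
          linarith
        -- Adjacent thresholds differ by the factor `exp 4`, which enters squared.
        have e : Real.exp 8 * t ^ 2 = (Real.exp (-(4 * (Q x : ℕ)))) ^ 2 := by
          rw [ht, ← Real.exp_nat_mul, ← Real.exp_nat_mul, ← Real.exp_add]
          congr 1
          push_cast
          ring
        rw [e]
        apply sqrt_sub_sqrt_sq_le_of_abs_sub_le (hp.1 x) (hq.1 x)
        -- Bin `0` has no threshold above it, but a relative difference never exceeds `1`.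
        rcases Nat.eq_zero_or_pos (Q x : ℕ) with h0 | h0
        · rw [h0]
          have := hp.1 x
          have := hq.1 x
          simp only [Nat.cast_zero, mul_zero, neg_zero, Real.exp_zero, one_mul]
          exact abs_le.2 ⟨by linarith, by linarith⟩
        · have := h₁ x (Q x - 1) (by omega)
          rw [Nat.cast_sub h0, Nat.cast_one, sub_add_cancel] at this
          rwa [hσabs, abs_of_nonneg hspos]
      have := mul_le_mul_of_nonneg_left h3 (Real.exp_nonneg 8)
      linarith
    · rw [Finset.sum_eq_zero]
      · positivity
      · intro x hx
        obtain rfl := (Finset.mem_filter.1 hx).2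
        simp only [hv, if_neg hy]
  have : hellingerSq p q = ∑ x, (√(p x) - √(q x)) ^ 2 := rfl
  linarith

/-! ## Randomized response -/

section

variable {ε : ℝ} {m : ℕ}

theorem isChannel_randResponse (hm : 1 ≤ m) : IsChannel (randResponse ε m) := by
  have hm' : (1 : ℝ) ≤ m := by exact_mod_cast hm
  have hE := Real.exp_pos ε
  have hM : 0 < (m - 1 : ℝ) + Real.exp ε := by linarith
  refine ⟨fun y x => ?_, fun x => ?_⟩
  · simp only [randResponse, Matrix.of_apply]
    split_ifs <;> positivity
  · have : ∑ y, randResponse ε m y x = 1 := by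
      simp only [randResponse, Matrix.of_apply]
      rw [Finset.sum_ite, Finset.sum_const, Finset.sum_const, Finset.filter_eq',
        if_pos (Finset.mem_univ _), Finset.filter_ne', Finset.card_erase_of_mem (Finset.mem_univ _), Finset.card_univ,
        Fintype.card_fin, Finset.card_singleton, nsmul_eq_mul, nsmul_eq_mul, Nat.cast_sub hm]
      field_simp
      push_cast
      ring
    rw [← this]
    exact hasSum_fintype _

theorem isLDP_randResponse (hε : 0 ≤ ε) : IsLDP ε (randResponse ε m) := by
  intro x x' y
  have hm' : (1 : ℝ) ≤ m := by
    have := x.2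
    exact_mod_cast (by omega : 1 ≤ m)
  have hE := Real.one_le_exp hε
  have hM : 0 < (m - 1 : ℝ) + Real.exp ε := by linarith
  simp only [randResponse, Matrix.of_apply]
  split_ifs <;> rw [← mul_div_assoc] <;> gcongr <;> nlinarith

/-- The matrix is a constant one plus a multiple of the identity, so `P` is only mixed with the
uniform law. -/
theorem randResponse_mulVec {P : Fin m → ℝ} (hP : P ∈ stdSimplex ℝ (Fin m)) (y : Fin m) :
    (randResponse ε m *ᵥ P) y =
      (1 + (Real.exp ε - 1) * P y) / ((m - 1 : ℝ) + Real.exp ε) := by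
  have : ∀ x, randResponse ε m y x * P x =
      (P x + (Real.exp ε - 1) * (if y = x then P x else 0)) / ((m - 1 : ℝ) + Real.exp ε) := by
    intro x
    simp only [randResponse, Matrix.of_apply]
    split_ifs <;> ring
  simp only [Matrix.mulVec, dotProduct, this]
  rw [← Finset.sum_div, Finset.sum_add_distrib, hP.2, ← Finset.mul_sum]
  simp

/-- Hellinger divergence after randomized response. -/
theorem hellingerSq_randResponse (hε : 1 < ε) (hm : 2 ≤ m) {P Q : Fin m → ℝ}
    (hP : P ∈ stdSimplex ℝ (Fin m)) (hQ : Q ∈ stdSimplex ℝ (Fin m)) :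
    hellingerSq P Q * min 1 (Real.exp ε * hellingerSq P Q / m) * min 1 (Real.exp ε / m) ≤
      192 * hellingerSq (randResponse ε m *ᵥ P) (randResponse ε m *ᵥ Q) := by
  set g := hellingerSq P Q with hg
  have hg0 : 0 ≤ g := hellingerSq_nonneg _ _
  set E := Real.exp ε
  have hE : 2 ≤ E := by linarith [Real.add_one_le_exp ε]
  have hm' : (2 : ℝ) ≤ m := by exact_mod_cast hm
  set M : ℝ := (m - 1 : ℝ) + E with hM
  have hM0 : 0 < M := by linarith
  -- Value of `w = (E - 1) (P y + Q y)` at the cut-off mass `g / (2m)`. The noise shrinks relative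
  -- differences by `w / (2 + w)`, which increases in `w`.
  set u : ℝ := (E - 1) * (g / (2 * m)) with hu
  have hu0 : 0 ≤ u := mul_nonneg (by linarith) (by positivity)
  have hpoint (y : Fin m) : (E - 1) / M * (u / (2 + u)) * ((√(P y) - √(Q y)) ^ 2 - g / (2 * m)) ≤
      2 * (√((randResponse ε m *ᵥ P) y) - √((randResponse ε m *ᵥ Q) y)) ^ 2 := by
    have hPy := hP.1 y
    have hQy := hQ.1 y
    have hcoef : 0 ≤ (E - 1) / M * (u / (2 + u)) :=
      mul_nonneg (div_nonneg (by linarith) hM0.le) (by positivity)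
    -- For light symbols the left side is nonpositive, so nothing has to be kept.
    by_cases hs : P y + Q y < g / (2 * m)
    · have := sqrt_sub_sqrt_sq_le_add hPy hQy
      refine (mul_nonpos_of_nonneg_of_nonpos hcoef (by linarith)).trans (by positivity)
    · rw [not_lt] at hs
      rw [randResponse_mulVec hP, randResponse_mulVec hQ]
      set w := (E - 1) * (P y + Q y) with hw
      have huw : u ≤ w := mul_le_mul_of_nonneg_left hs (by linarith)
      have hw0 : 0 ≤ w := hu0.trans huw
      rcases (add_nonneg hPy hQy).eq_or_lt with h0 | h0
      · have : P y = 0 := by linarith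
        have h' : Q y = 0 := by linarith
        simp only [this, h']
        refine (mul_nonpos_of_nonneg_of_nonpos hcoef ?_).trans (by positivity)
        have : 0 ≤ g / (2 * m) := by positivity
        simpa
      set t := |P y - Q y| / (P y + Q y) with ht
      have ht0 : 0 ≤ t := by positivity
      have b1 : (√(P y) - √(Q y)) ^ 2 ≤ t ^ 2 * (P y + Q y) :=
        sqrt_sub_sqrt_sq_le_of_abs_sub_le hPy hQy (by rw [ht, div_mul_cancel₀ _ h0.ne'])
      have b2 := sq_mul_add_le_of_mul_le_abs_sub (a := (1 + (E - 1) * P y) / M)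
        (b := (1 + (E - 1) * Q y) / M) (t := t * (w / (2 + w)))
        (div_nonneg (by nlinarith) hM0.le) (div_nonneg (by nlinarith) hM0.le) (by positivity) (by
          rw [← sub_div, ← add_div, abs_div, abs_of_pos hM0, ← mul_div_assoc]
          gcongr
          have e1 : 1 + (E - 1) * P y + (1 + (E - 1) * Q y) = 2 + w := by rw [hw]; ring
          have e2 : 1 + (E - 1) * P y - (1 + (E - 1) * Q y) = (E - 1) * (P y - Q y) := by ring
          rw [e1, e2, mul_assoc, div_mul_cancel₀ _ (by positivity), abs_mul,
            abs_of_nonneg (by linarith : 0 ≤ E - 1), hw, ht]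
          field_simp
          exact le_rfl)
      refine le_trans ?_ b2
      have e3 : (t * (w / (2 + w))) ^ 2 *
          ((1 + (E - 1) * P y) / M + (1 + (E - 1) * Q y) / M) =
          (E - 1) / M * (w / (2 + w)) * (t ^ 2 * (P y + Q y)) := by
        have e1 : (1 + (E - 1) * P y) / M + (1 + (E - 1) * Q y) / M = (2 + w) / M := by
          rw [hw]; ring
        rw [e1]
        have : 2 + w ≠ 0 := by positivity
        field_simp
        rw [hw]
        ring
      rw [e3]
      have hmono : u / (2 + u) ≤ w / (2 + w) := by
        rw [div_le_div_iff₀ (by positivity) (by positivity)]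
        nlinarith
      have h5 : (√(P y) - √(Q y)) ^ 2 - g / (2 * m) ≤ t ^ 2 * (P y + Q y) := by
        have : 0 ≤ g / (2 * m) := by positivity
        linarith
      refine (mul_le_mul_of_nonneg_left h5 hcoef).trans ?_
      refine mul_le_mul_of_nonneg_right ?_ (by positivity)
      exact mul_le_mul_of_nonneg_left hmono (div_nonneg (by linarith) hM0.le)
  have hsum := Finset.sum_le_sum fun y (_ : y ∈ Finset.univ) => hpoint y
  rw [← Finset.mul_sum, ← Finset.mul_sum, Finset.sum_sub_distrib, Finset.sum_const,
    Finset.card_univ, Fintype.card_fin, nsmul_eq_mul] at hsum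
  -- The `m` cut-offs together cost half of the divergence.
  have e4 : ∑ y, (√(P y) - √(Q y)) ^ 2 - m * (g / (2 * m)) = g / 2 := by
    change g - m * (g / (2 * m)) = g / 2
    have : (m : ℝ) ≠ 0 := by positivity
    field_simp
    ring
  rw [e4] at hsum
  have f1 : min 1 (E / m) ≤ 4 * ((E - 1) / M) := by
    rw [← mul_div_assoc, le_div_iff₀ hM0]
    rcases le_total E m with h | h
    · have : min 1 (E / m) ≤ E / m := min_le_right _ _
      have h2 : E / m * M ≤ E / m * (2 * m) := by gcongr; linarith
      have h3 : E / m * (2 * m) = 2 * E := by field_simp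
      nlinarith
    · nlinarith [min_le_left 1 (E / m)]
  have f2 : min 1 (E * g / m) ≤ 12 * (u / (2 + u)) := by
    have hu' : E * g / m ≤ 4 * u := by
      have : 4 * u - E * g / m = (E - 2) * (g / m) := by
        rw [hu]
        have : (m : ℝ) ≠ 0 := by positivity
        field_simp
        ring
      have : 0 ≤ (E - 2) * (g / m) := mul_nonneg (by linarith) (by positivity)
      linarith
    rw [← mul_div_assoc, le_div_iff₀ (by positivity)]
    rcases le_total u 1 with h | h
    · nlinarith [min_le_right 1 (E * g / m)]
    · nlinarith [min_le_left 1 (E * g / m)]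
  have f3 : 0 ≤ min 1 (E / m) := by positivity
  have f4 : 0 ≤ min 1 (E * g / m) := by positivity
  -- The constant `192` is `4 * 12` from `f1` and `f2`, times `4` from `hsum`.
  have f5 := mul_le_mul f1 f2 f4 (f3.trans f1)
  have f6 := mul_le_mul_of_nonneg_left f5 hg0
  change (E - 1) / M * (u / (2 + u)) * (g / 2) ≤ 2 * hellingerSq _ _ at hsum
  linarith

end

/-! ## Program logic for the real RAM -/

/-- Total correctness with a time bound: `c`, started in `s`, halts within `B` steps in a memory
satisfying `P`. -/
def RunsWithin (c : RAMProgram) (s : RAMState) (B : ℕ) (P : RAMState → Prop) : Prop :=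
  ∃ t s', RAMRuns c s t s' ∧ t ≤ B ∧ P s'

namespace RunsWithin

variable {c c₁ c₂ : RAMProgram} {s : RAMState} {B B₁ B₂ : ℕ} {P R : RAMState → Prop} {b : RAMTest}

theorem mono (h : RunsWithin c s B₁ P) (hB : B₁ ≤ B) (hP : ∀ s', P s' → R s') :
    RunsWithin c s B R := by
  obtain ⟨t, s', hr, ht, hs⟩ := h
  exact ⟨t, s', hr, ht.trans hB, hP _ hs⟩

theorem setNat {r : ℕ} {e : NatExpr} (h : P (s.setNat r (e.eval s))) :
    RunsWithin (.setNat r e) s 1 P :=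
  ⟨1, _, .setNat r e s, le_rfl, h⟩

theorem setReal {a : ℕ} {i j : NatExpr} {e : RealExpr}
    (h : P (s.setReal a (i.eval s) (j.eval s) (e.eval s))) :
    RunsWithin (.setReal a i j e) s 1 P :=
  ⟨1, _, .setReal a i j e s, le_rfl, h⟩

theorem seq (h₁ : RunsWithin c₁ s B₁ R) (h₂ : ∀ s', R s' → RunsWithin c₂ s' B₂ P) :
    RunsWithin (.seq c₁ c₂) s (B₁ + B₂) P := by
  obtain ⟨t₁, s₁, hr₁, ht₁, hs₁⟩ := h₁
  obtain ⟨t₂, s₂, hr₂, ht₂, hs₂⟩ := h₂ s₁ hs₁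
  exact ⟨_, s₂, .seq hr₁ hr₂, by omega, hs₂⟩

theorem ite (h₁ : b.Holds s → RunsWithin c₁ s B P) (h₂ : ¬ b.Holds s → RunsWithin c₂ s B P) :
    RunsWithin (.ite b c₁ c₂) s (B + 1) P := by
  by_cases hb : b.Holds s
  · obtain ⟨t, s', hr, ht, hs⟩ := h₁ hb
    exact ⟨_, s', .iteTrue hb hr, by omega, hs⟩
  · obtain ⟨t, s', hr, ht, hs⟩ := h₂ hb
    exact ⟨_, s', .iteFalse hb hr, by omega, hs⟩

/-- Loop rule: the invariant `I` is preserved and the measure `μ` decreases. -/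
theorem loop (I : RAMState → Prop) (μ : RAMState → ℕ) (N : ℕ) (hI : I s) (hN : μ s ≤ N)
    (h : ∀ s, I s → b.Holds s → RunsWithin c s B fun s' => I s' ∧ μ s' < μ s)
    (hP : ∀ s, I s → ¬ b.Holds s → P s) :
    RunsWithin (.loop b c) s ((B + 1) * N + 1) P := by
  induction N generalizing s with
  | zero =>
    by_cases hb : b.Holds s
    · obtain ⟨t, s', -, -, -, hμ⟩ := h s hI hb
      omega
    · exact ⟨1, s, .loopDone hb, by omega, hP s hI hb⟩
  | succ N ih =>
    by_cases hb : b.Holds s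
    · obtain ⟨t, s', hr, ht, hI', hμ⟩ := h s hI hb
      obtain ⟨t', s'', hr', ht', hs⟩ := ih hI' (by omega)
      exact ⟨_, s'', .loopStep hb hr hr', by rw [Nat.mul_succ]; omega, hs⟩
    · exact ⟨1, s, .loopDone hb, by omega, hP s hI hb⟩

end RunsWithin

/-! ## The quantization program

Registers: `0` is `k`, `1` is `m`, `2` the input symbol, `3` its bin, `4` the output symbol.
Array `4` holds the signed Hellinger sum, the Hellinger divergence and the sign of the former. -/

namespace QuantProgram

def K : NatExpr := .reg 0
def M : NatExpr := .reg 1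
def X : NatExpr := .reg 2
def J : NatExpr := .reg 3
def Y : NatExpr := .reg 4
def pX : RealExpr := .cell 0 (.const 0) X
def qX : RealExpr := .cell 1 (.const 0) X
def num (n : ℕ) : RealExpr := .ofNat (.const n)
def scratch (n : ℕ) : RealExpr := .cell 4 (.const 0) (.const n)
def setScratch (n : ℕ) (e : RealExpr) : RAMProgram := .setReal 4 (.const 0) (.const n) e
def incr (r : ℕ) : RAMProgram := .setNat r (.add (.reg r) (.const 1))
def diff : RealExpr := .sub (.sqrt pX) (.sqrt qX)
def expEps : RealExpr := .exp (.cell 2 (.const 0) (.const 0))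
def denom : RealExpr := .add (.sub (.ofNat M) (num 1)) expEps

/-- Computes the Hellinger divergence and its signed version. -/
def sums : RAMProgram :=
  .loop (.natLt X K)
    -- The absolute value is obtained as the root of the square.
    (.seq (setScratch 0 (.add (scratch 0) (.mul diff (.sqrt (.mul diff diff)))))
      (.seq (setScratch 1 (.add (scratch 1) (.mul diff diff))) (incr 2)))

/-- Computes the sign. -/
def sign : RAMProgram :=
  .ite (.realLt (scratch 0) (num 0)) (setScratch 2 (.sub (num 0) (num 1))) (setScratch 2 (num 1))

/-- Computes the number of bins. -/
def size : RAMProgram :=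
  .seq (.setNat 1 (.const 2))
    -- Reals cannot be rounded, so the ceiling is found by counting up; the bound `K` keeps this
    -- polynomial.
    (.loop (.both (.natLt M K) (.realLt (.ofNat M) (.log (.div (num 1) (scratch 1))))) (incr 1))

/-- The sign-adjusted relative difference of `p` and `q` exceeds the threshold of the current bin. -/
def above : RAMTest :=
  .realLt (.mul (.exp (.sub (num 0) (.mul (num 4) (.ofNat (.add J (.const 1)))))) (.add pX qX))
    (.mul (scratch 2) (.sub pX qX))

/-- Computes the bin of the current symbol. -/
def bin : RAMProgram :=
  .ite (.natLt M K)
    (.seq (.setNat 3 (.const 0))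
      (.loop (.both (.natLt (.add J (.const 1)) M) (.neg above)) (incr 3)))
    (.setNat 3 X)

/-- Writes the column of the output matrix for the current symbol. -/
def column : RAMProgram :=
  .seq (.setNat 4 (.const 0))
    (.loop (.natLt Y M)
      (.seq
        (.ite (.both (.neg (.natLt Y J)) (.neg (.natLt J Y)))
          (.setReal 3 Y X (.div expEps denom)) (.setReal 3 Y X (.div (num 1) denom)))
        (incr 4)))

def columns : RAMProgram :=
  .seq (.setNat 2 (.const 0)) (.loop (.natLt X K) (.seq bin (.seq column (incr 2))))

def prog : RAMProgram := .seq sums (.seq sign (.seq size columns))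

/-- `j` is the bin of a symbol with masses `a` and `b` in a quantizer with `m` bins. -/
def IsBin (σ : ℝ) (m : ℕ) (a b : ℝ) (j : ℕ) : Prop :=
  j < m ∧ (∀ i < j, σ * (a - b) ≤ Real.exp (-(4 * (i + 1))) * (a + b)) ∧
    (j + 1 < m → Real.exp (-(4 * (j + 1))) * (a + b) < σ * (a - b))

/-- The bin chosen for the symbol `x`. -/
def Chosen (σ : ℝ) (k m : ℕ) (a b : ℝ) (x j : ℕ) : Prop :=
  (m < k ∧ IsBin σ m a b j) ∨ (¬ m < k ∧ j = x)

/-- The input is unchanged. -/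
def Frame (k : ℕ) (f g : ℕ → ℝ) (ε : ℝ) (s : RAMState) : Prop :=
  s.nat 0 = k ∧ (∀ x, s.real 0 0 x = f x) ∧ (∀ x, s.real 1 0 x = g x) ∧ s.real 2 0 0 = ε

section

variable {k m : ℕ} {f g : ℕ → ℝ} {ε σ : ℝ} {s : RAMState}

attribute [local simp] K M X J Y pX qX num scratch setScratch incr diff expEps denom above
  RAMTest.Holds NatExpr.eval RealExpr.eval RAMState.setNat RAMState.setReal

theorem runs_sums (h : Frame k f g ε s) (hX : s.nat 2 = 0) (h0 : s.real 4 0 0 = 0)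
    (h1 : s.real 4 0 1 = 0) :
    RunsWithin sums s (4 * k + 1) fun s' => Frame k f g ε s' ∧
      s'.real 4 0 0 = ∑ x ∈ Finset.range k, (√(f x) - √(g x)) * |√(f x) - √(g x)| ∧
      s'.real 4 0 1 = ∑ x ∈ Finset.range k, (√(f x) - √(g x)) ^ 2 := by
  refine RunsWithin.loop (B := 3) (fun s' => Frame k f g ε s' ∧ s'.nat 2 ≤ k ∧
      s'.real 4 0 0 = ∑ x ∈ Finset.range (s'.nat 2), (√(f x) - √(g x)) * |√(f x) - √(g x)| ∧
      s'.real 4 0 1 = ∑ x ∈ Finset.range (s'.nat 2), (√(f x) - √(g x)) ^ 2)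
    (fun s' => k - s'.nat 2) k ?_ (by omega) ?_ ?_
  · simp [h, hX, h0, h1]
  · rintro s ⟨⟨hk, hf, hg, he⟩, -, h0, h1⟩ hb
    refine (RunsWithin.seq (RunsWithin.setReal rfl) fun _ e => ?_ : RunsWithin _ _ (1 + (1 + 1)) _)
    subst e
    refine RunsWithin.seq (RunsWithin.setReal rfl) fun _ e => ?_
    subst e
    refine RunsWithin.setNat ?_
    simp [hk] at hb
    simp [Frame, hk, hf, hg, he, h0, h1, Finset.sum_range_succ, Real.sqrt_mul_self_eq_abs]
    refine ⟨⟨hb, by ring⟩, by omega⟩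
  · rintro s ⟨hF, hle, h0, h1⟩ hb
    simp [hF.1] at hb
    have : s.nat 2 = k := by omega
    rw [this] at h0 h1
    exact ⟨hF, h0, h1⟩

theorem runs_sign (h : Frame k f g ε s) :
    RunsWithin sign s 2 fun s' => Frame k f g ε s' ∧ s'.real 4 0 1 = s.real 4 0 1 ∧
      s'.real 4 0 2 = if s.real 4 0 0 < 0 then -1 else 1 := by
  obtain ⟨hk, hf, hg, he⟩ := h
  refine RunsWithin.ite (fun hb => RunsWithin.setReal ?_) fun hb => RunsWithin.setReal ?_
  · simp at hb
    simp [Frame, hk, hf, hg, he, hb]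
  · simp at hb
    simp [Frame, hk, hf, hg, he, hb]

theorem runs_size (hk2 : 2 ≤ k) (h : Frame k f g ε s) :
    RunsWithin size s (2 * k + 2) fun s' => Frame k f g ε s' ∧ s'.real 4 = s.real 4 ∧
      s'.nat 1 = max 2 (min ⌈Real.log (1 / s.real 4 0 1)⌉₊ k) := by
  obtain ⟨hk, hf, hg, he⟩ := h
  refine (RunsWithin.seq (RunsWithin.setNat rfl) fun _ e => ?_ :
    RunsWithin _ _ (1 + ((1 + 1) * k + 1)) _).mono (by omega) fun _ => id
  subst e
  refine RunsWithin.loop (fun s' => Frame k f g ε s' ∧ s'.real 4 = s.real 4 ∧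
      2 ≤ s'.nat 1 ∧ s'.nat 1 ≤ max 2 (min ⌈Real.log (1 / s.real 4 0 1)⌉₊ k))
    (fun s' => k - s'.nat 1) k ?_ (by omega) ?_ ?_
  · simp [Frame, hk, hf, hg, he]
  · rintro s' ⟨⟨hk, hf, hg, he⟩, h4, h2, hle⟩ hb
    refine RunsWithin.setNat ?_
    simp [hk, h4] at hb
    -- An integer lies below a real exactly when it lies below its ceiling, so the increment cannot
    -- overshoot.
    have hlt : s'.nat 1 < ⌈Real.log (1 / s.real 4 0 1)⌉₊ := Nat.lt_ceil.2 (by simpa using hb.2)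
    simp only [NatExpr.eval, RAMState.setNat, Function.update_self]
    exact ⟨⟨by simp [Frame, hk, hf, hg, he], h4, by omega, by omega⟩, by omega⟩
  · rintro s' ⟨hF, h4, h2, hle⟩ hb
    refine ⟨hF, h4, le_antisymm hle ?_⟩
    simp [hF.1, h4] at hb
    by_cases hlt : s'.nat 1 < k
    · have hle' : ⌈Real.log (1 / s.real 4 0 1)⌉₊ ≤ s'.nat 1 := Nat.ceil_le.2 (by simpa using hb hlt)
      omega
    · omega

theorem runs_bin (hm : 2 ≤ m) (h : Frame k f g ε s) (h1 : s.nat 1 = m) (hσ : s.real 4 0 2 = σ) :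
    RunsWithin bin s (2 * m + 3) fun s' => Frame k f g ε s' ∧ s'.real = s.real ∧ s'.nat 1 = m ∧
      s'.nat 2 = s.nat 2 ∧ Chosen σ k m (f (s.nat 2)) (g (s.nat 2)) (s.nat 2) (s'.nat 3) := by
  obtain ⟨hk, hf, hg, he⟩ := h
  refine RunsWithin.ite (B := 2 * m + 2) (fun hb => ?_) fun hb => ?_
  · simp [hk, h1] at hb
    refine (RunsWithin.seq (RunsWithin.setNat rfl) fun _ e => ?_ :
      RunsWithin _ _ (1 + ((1 + 1) * m + 1)) _).mono (by omega) fun _ => id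
    subst e
    -- The invariant records the thresholds already failed; the exit test supplies the lower bound
    -- defining the bin.
    refine RunsWithin.loop (fun s' => Frame k f g ε s' ∧ s'.real = s.real ∧ s'.nat 1 = m ∧
      s'.nat 2 = s.nat 2 ∧ s'.nat 3 < m ∧ ∀ i < s'.nat 3, σ * (f (s.nat 2) - g (s.nat 2)) ≤
        Real.exp (-(4 * (i + 1))) * (f (s.nat 2) + g (s.nat 2)))
      (fun s' => m - s'.nat 3) m ?_ (by omega) ?_ ?_
    · simp [Frame, hk, hf, hg, he, h1]
      omega
    · rintro s' ⟨⟨hk, hf, hg, he⟩, hr, h1, h2, h3, hi⟩ hb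
      refine RunsWithin.setNat ?_
      simp [hf, hg, h1, h2] at hb
      rw [hr, hσ] at hb
      simp only [RAMState.setNat, NatExpr.eval, Function.update_self]
      refine ⟨⟨by simp [Frame, hk, hf, hg, he], hr, by simpa using h1, by simpa using h2, hb.1,
        fun i hi' => ?_⟩, by omega⟩
      rcases Nat.lt_succ_iff_lt_or_eq.1 hi' with h | rfl
      · exact hi i h
      · exact hb.2
    · rintro s' ⟨⟨hk, hf, hg, he⟩, hr, h1, h2, h3, hi⟩ hb'
      simp [hf, hg, h1, h2] at hb'
      rw [hr, hσ] at hb'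
      exact ⟨⟨hk, hf, hg, he⟩, hr, h1, h2, Or.inl ⟨hb, h3, hi, hb'⟩⟩
  · refine RunsWithin.mono (B₁ := 1) (RunsWithin.setNat rfl) (by omega) fun _ e => ?_
    subst e
    simp [hk, h1] at hb
    simp [Frame, hk, hf, hg, he, h1, Chosen, hb]

/-- That all other columns are untouched is what lets the outer loop accumulate the matrix. -/
theorem runs_column (h : Frame k f g ε s) (h1 : s.nat 1 = m) :
    RunsWithin column s (4 * m + 2) fun s' => Frame k f g ε s' ∧ s'.real 4 = s.real 4 ∧
      s'.nat 1 = m ∧ s'.nat 2 = s.nat 2 ∧ (∀ y x, x ≠ s.nat 2 → s'.real 3 y x = s.real 3 y x) ∧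
      ∀ y < m, s'.real 3 y (s.nat 2) = if y = s.nat 3 then
        Real.exp ε / ((m - 1 : ℝ) + Real.exp ε) else 1 / ((m - 1 : ℝ) + Real.exp ε) := by
  obtain ⟨hk, hf, hg, he⟩ := h
  refine (RunsWithin.seq (RunsWithin.setNat rfl) fun _ e => ?_ :
    RunsWithin _ _ (1 + ((3 + 1) * m + 1)) _).mono (by omega) fun _ => id
  subst e
  refine RunsWithin.loop (fun s' => Frame k f g ε s' ∧ s'.real 4 = s.real 4 ∧
      s'.nat 1 = m ∧ s'.nat 2 = s.nat 2 ∧ s'.nat 3 = s.nat 3 ∧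
      (∀ y x, x ≠ s.nat 2 → s'.real 3 y x = s.real 3 y x) ∧
      ∀ y < s'.nat 4, s'.real 3 y (s.nat 2) = if y = s.nat 3 then
        Real.exp ε / ((m - 1 : ℝ) + Real.exp ε) else 1 / ((m - 1 : ℝ) + Real.exp ε))
    (fun s' => m - s'.nat 4) m ?_ (by omega) ?_ ?_
  · simp [Frame, hk, hf, hg, he, h1]
  · rintro s' ⟨⟨hk, hf, hg, he⟩, h4, h1, h2, h3, hx, hy⟩ hb
    simp [h1] at hb
    refine RunsWithin.seq (B₁ := 2) (B₂ := 1) (R := fun s'' => Frame k f g ε s'' ∧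
      s''.real 4 = s.real 4 ∧ s''.nat = s'.nat ∧
      (∀ y x, x ≠ s.nat 2 → s''.real 3 y x = s.real 3 y x) ∧
      ∀ y < s'.nat 4 + 1, s''.real 3 y (s.nat 2) = if y = s.nat 3 then
        Real.exp ε / ((m - 1 : ℝ) + Real.exp ε) else 1 / ((m - 1 : ℝ) + Real.exp ε)) ?_ ?_
    · refine RunsWithin.ite (B := 1) (fun hb => RunsWithin.setReal ?_)
        fun hb => RunsWithin.setReal ?_
      · simp [h3] at hb
        have e : s'.nat 4 = s.nat 3 := by omega
        simp only [NatExpr.eval, RealExpr.eval, Y, X, M, denom, expEps, num, RAMState.setReal, h1,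
          h2, he]
        refine ⟨by simp [Frame, hk, hf, hg, he], by simp [h4], trivial,
          fun y x hxx => by simp [hxx, hx], fun y hyy => ?_⟩
        by_cases hye : y = s'.nat 4
        · simp [hye, e]
        · simp [hye, hy y (by omega)]
      · simp [h3] at hb
        have e : s'.nat 4 ≠ s.nat 3 := by omega
        simp only [NatExpr.eval, RealExpr.eval, Y, X, M, denom, expEps, num, RAMState.setReal, h1,
          h2, he]
        refine ⟨by simp [Frame, hk, hf, hg, he], by simp [h4], trivial,
          fun y x hxx => by simp [hxx, hx], fun y hyy => ?_⟩
        by_cases hye : y = s'.nat 4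
        · simp [hye, e]
        · simp [hye, hy y (by omega)]
    · rintro s'' ⟨⟨hk, hf, hg, he⟩, h4', hn, hx', hy'⟩
      refine RunsWithin.setNat ?_
      simp only [NatExpr.eval, RAMState.setNat, hn, Function.update_self]
      exact ⟨⟨by simp [Frame, hk, hf, hg, he, ← hn], h4', by simp [h1], by simp [h2],
        by simp [h3], hx', hy'⟩, by omega⟩
  · rintro s' ⟨hF, h4, h1, h2, h3, hx, hy⟩ hb
    simp [h1] at hb
    exact ⟨hF, h4, h1, h2, hx, fun y hym => hy y (by omega)⟩

theorem runs_columns (hm : 2 ≤ m) (h : Frame k f g ε s) (h1 : s.nat 1 = m)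
    (hσ : s.real 4 0 2 = σ) :
    RunsWithin columns s ((6 * m + 7) * k + 2) fun s' => s'.nat 1 = m ∧
      ∀ x < k, ∃ j, Chosen σ k m (f x) (g x) x j ∧ ∀ y < m, s'.real 3 y x = if y = j then
        Real.exp ε / ((m - 1 : ℝ) + Real.exp ε) else 1 / ((m - 1 : ℝ) + Real.exp ε) := by
  obtain ⟨hk, hf, hg, he⟩ := h
  refine (RunsWithin.seq (RunsWithin.setNat rfl) fun _ e => ?_ :
    RunsWithin _ _ (1 + ((6 * m + 6 + 1) * k + 1)) _).mono (by rw [add_assoc]; omega) fun _ => id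
  subst e
  refine RunsWithin.loop (fun s' => Frame k f g ε s' ∧ s'.real 4 0 2 = σ ∧ s'.nat 1 = m ∧
      ∀ x < s'.nat 2, ∃ j, Chosen σ k m (f x) (g x) x j ∧ ∀ y < m, s'.real 3 y x = if y = j then
        Real.exp ε / ((m - 1 : ℝ) + Real.exp ε) else 1 / ((m - 1 : ℝ) + Real.exp ε))
    (fun s' => k - s'.nat 2) k ?_ (by omega) ?_ ?_
  · simp [Frame, hk, hf, hg, he, h1, hσ]
  · rintro s' ⟨hF, h4, h1, hx⟩ hb
    simp [hF.1] at hb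
    refine (RunsWithin.seq (runs_bin hm hF h1 h4) ?_ :
      RunsWithin _ _ ((2 * m + 3) + ((4 * m + 2) + 1)) _).mono (by omega) fun _ => id
    rintro s₁ ⟨hF₁, hr₁, h1₁, h2₁, hc⟩
    refine RunsWithin.seq (runs_column hF₁ h1₁) ?_
    rintro s₂ ⟨⟨hk, hf, hg, he⟩, h4₂, h1₂, h2₂, hx₂, hy₂⟩
    refine RunsWithin.setNat ?_
    rw [h2₁] at h2₂ hx₂ hy₂
    rw [hr₁] at h4₂ hx₂
    simp only [NatExpr.eval, RAMState.setNat, Function.update_self, h2₂]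
    refine ⟨⟨by simp [Frame, hk, hf, hg, he], by rw [h4₂, h4], by simp [h1₂], fun x hxx => ?_⟩,
      by omega⟩
    by_cases hxe : x = s'.nat 2
    · subst hxe
      exact ⟨_, hc, hy₂⟩
    · obtain ⟨j, hj, hy⟩ := hx x (by omega)
      exact ⟨j, hj, fun y hym => by rw [hx₂ y x hxe, hy y hym]⟩
  · rintro s' ⟨hF, -, h1, hx⟩ hb
    simp [hF.1] at hb
    exact ⟨h1, fun x hxk => hx x (by omega)⟩

end

theorem outputs {k : ℕ} (hk : 2 ≤ k) (p q : Fin k → ℝ) (ε : ℝ) :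
    ∃ (σ : ℝ) (Q : Fin k → Fin (quantSize p q)) (t : ℕ),
      σ = (if ∑ x, (√(p x) - √(q x)) * |√(p x) - √(q x)| < 0 then -1 else 1) ∧
      (∀ x, Chosen σ k (quantSize p q) (p x) (q x) x (Q x)) ∧
      RAMOutputs prog p q ε t (randResponse ε (quantSize p q) * detChannel Q) ∧
      t ≤ 30 * k ^ 2 := by
  -- Memory is indexed by `ℕ`, hence the extension by zero.
  set f : ℕ → ℝ := fun j => if h : j < k then p ⟨j, h⟩ else 0
  set g : ℕ → ℝ := fun j => if h : j < k then q ⟨j, h⟩ else 0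
  have hfp (x : Fin k) : f x = p x := by simp [f]
  have hgq (x : Fin k) : g x = q x := by simp [g]
  set σ : ℝ := if ∑ x, (√(p x) - √(q x)) * |√(p x) - √(q x)| < 0 then -1 else 1
  have h2m : 2 ≤ quantSize p q := le_max_left _ _
  have hmk : quantSize p q ≤ k := max_le hk (min_le_right _ _)
  set m := quantSize p q with hm
  have hrun : RunsWithin prog (ramInput p q ε) (30 * k ^ 2) fun s' => s'.nat 1 = m ∧
      ∀ x < k, ∃ j, Chosen σ k m (f x) (g x) x j ∧ ∀ y < m, s'.real 3 y x = if y = j then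
        Real.exp ε / ((m - 1 : ℝ) + Real.exp ε) else 1 / ((m - 1 : ℝ) + Real.exp ε) := by
    refine (RunsWithin.seq (runs_sums (k := k) (f := f) (g := g) (ε := ε) ?_ ?_ ?_ ?_) ?_ :
      RunsWithin _ _ ((4 * k + 1) + (2 + ((2 * k + 2) + ((6 * m + 7) * k + 2)))) _).mono ?_
      fun _ => id
    · refine ⟨?_, fun x => ?_, fun x => ?_, ?_⟩ <;> simp [ramInput, f, g]
    · simp [ramInput]
    · simp [ramInput]
    · simp [ramInput]
    · rintro s₁ ⟨hF₁, hS, hH⟩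
      refine RunsWithin.seq (runs_sign hF₁) ?_
      rintro s₂ ⟨hF₂, hH₂, hσ₂⟩
      refine RunsWithin.seq (runs_size hk hF₂) ?_
      rintro s₃ ⟨hF₃, h4₃, h1₃⟩
      refine runs_columns h2m hF₃ ?_ ?_
      · rw [h1₃, hH₂, hH, Finset.sum_range]
        simp only [hfp, hgq, hm, quantSize, hellingerSq]
      · rw [h4₃, hσ₂, hS, Finset.sum_range]
        simp only [hfp, hgq, σ]
    -- The total is `6mk + 13k + 7`, and `m ≤ k`, `k ≥ 2`.
    · nlinarith [Nat.mul_le_mul_right k hmk]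
  obtain ⟨t, s, hr, ht, h1, hx⟩ := hrun
  choose! j hj hy using hx
  have hjm (x : Fin k) : j x < m := by
    rcases hj x x.2 with h | h
    · exact h.2.1
    · rw [h.2]
      omega
  refine ⟨σ, fun x => ⟨j x, hjm x⟩, t, rfl, fun x => ?_, ⟨s, hr, h1, fun r x => ?_⟩, ht⟩
  · simpa only [hfp, hgq] using hj x x.2
  · rw [hy x x.2 r r.2]
    rw [mul_detChannel_apply]
    simp only [randResponse, Matrix.of_apply, Fin.ext_iff]

end QuantProgram

/-! ## Sample complexity and Hellinger divergence -/

section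

variable {Y : Type} {n : ℕ}

theorem productProb_of_fintype [Fintype Y] (P : Fin n → Y → ℝ) (A : Set (Fin n → Y))
    [DecidablePred (· ∈ A)] :
    productProb P A = ∑ y, if y ∈ A then ∏ i, P i (y i) else 0 := by
  rw [productProb, tsum_fintype]
  exact Finset.sum_congr rfl fun y _ => by simp [Set.indicator_apply]

theorem productProb_nonneg {P : Fin n → Y → ℝ} (h0 : ∀ i y, 0 ≤ P i y) (A : Set (Fin n → Y)) :
    0 ≤ productProb P A :=
  tsum_nonneg fun _ => Set.indicator_nonneg (fun _ _ => Finset.prod_nonneg fun _ _ => h0 _ _) _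

theorem productProb_false_add_true {P : Fin n → Y → ℝ} (h0 : ∀ i y, 0 ≤ P i y)
    (h1 : ∀ i, HasSum (P i) 1) (φ : (Fin n → Y) → Bool) :
    productProb P {y | φ y = false} + productProb P {y | φ y = true} = 1 := by
  have h := hasSum_prod_mass P h0 h1
  rw [productProb, productProb,
    ← (h.summable.indicator _).tsum_add (h.summable.indicator _), ← h.tsum_eq]
  refine tsum_congr fun y => ?_
  cases hy : φ y <;> simp [hy]

/-- The output law of product channels is a mixture over the inputs. -/
theorem productProb_mulVec {X : Type} [Fintype X] {R : Fin n → Matrix Y X ℝ}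
    (hR : ∀ i, IsChannel (R i)) (p : X → ℝ) (A : Set (Fin n → Y)) :
    productProb (fun i => R i *ᵥ p) A =
      ∑ x : Fin n → X, (∏ i, p (x i)) * productProb (fun i y => R i y (x i)) A := by
  classical
  have hsum (x : Fin n → X) : Summable fun y : Fin n → Y => ∏ i, R i (y i) (x i) :=
    (hasSum_prod_mass (fun i y => R i y (x i)) (fun i y => (hR i).1 _ _)
      fun i => (hR i).2 _).summable
  simp only [productProb, ← tsum_mul_left]
  rw [← Summable.tsum_finsetSum fun x _ => ((hsum x).indicator A).mul_left _]
  refine tsum_congr fun y => ?_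
  by_cases hy : y ∈ A
  · simp only [Set.indicator_of_mem hy, Matrix.mulVec, dotProduct, Finset.prod_univ_sum,
      Fintype.piFinset_univ, ← Finset.prod_mul_distrib]
    exact Finset.sum_congr rfl fun x _ => Finset.prod_congr rfl fun i _ => mul_comm _ _
  · simp [Set.indicator_of_notMem hy]

/-- The Bhattacharyya coefficient is multiplicative over independent samples: expand the power of
the sum. Both directions of the sample complexity bound use this. -/
theorem sum_sqrt_prod_mul_sqrt_prod {X : Type} [Fintype X] {p q : X → ℝ}
    (hp : p ∈ stdSimplex ℝ X) (hq : q ∈ stdSimplex ℝ X) (n : ℕ) :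
    ∑ x : Fin n → X, √(∏ i, p (x i)) * √(∏ i, q (x i)) = (1 - hellingerSq p q / 2) ^ n := by
  classical
  rw [← sum_sqrt_mul_sqrt hp hq, ← Fin.prod_const, Finset.prod_univ_sum, Fintype.piFinset_univ]
  refine Finset.sum_congr rfl fun x _ => ?_
  rw [Real.sqrt_prod _ fun i _ => hp.1 _, Real.sqrt_prod _ fun i _ => hq.1 _,
    Finset.prod_mul_distrib]

theorem sum_prod_eq_one {X : Type} [Fintype X] {p : X → ℝ} (hp : p ∈ stdSimplex ℝ X) (n : ℕ) :
    ∑ x : Fin n → X, ∏ i, p (x i) = 1 := by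
  classical
  rw [← Fintype.piFinset_univ, ← Finset.prod_univ_sum, Fin.prod_const, hp.2, one_pow]

/-- Necessity: `1 / H²` samples are needed, whatever the channels. -/
theorem one_le_mul_hellingerSq {X : Type} [Fintype X] {p q : X → ℝ} {𝒞 : Set (Matrix Y X ℝ)}
    (hp : p ∈ stdSimplex ℝ X) (hq : q ∈ stdSimplex ℝ X) (h𝒞 : ∀ T ∈ 𝒞, IsChannel T)
    (h : SolvableWith 𝒞 p q n) : 1 ≤ n * hellingerSq p q := by
  obtain ⟨R, hR𝒞, φ, herr⟩ := h
  have hR i := h𝒞 _ (hR𝒞 i)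
  rw [productProb_mulVec hR, productProb_mulVec hR, ← Finset.sum_add_distrib] at herr
  have hp0 (x : Fin n → X) : 0 ≤ ∏ i, p (x i) := Finset.prod_nonneg fun _ _ => hp.1 _
  have hq0 (x : Fin n → X) : 0 ≤ ∏ i, q (x i) := Finset.prod_nonneg fun _ _ => hq.1 _
  -- Conditionally on the inputs the two verdicts have total probability one, so each input tuple
  -- contributes at least the smaller of its two masses.
  have hmin : ∑ x : Fin n → X, min (∏ i, p (x i)) (∏ i, q (x i)) ≤ 0.1 := by
    refine le_trans (Finset.sum_le_sum fun x _ => ?_) herr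
    have h1 := productProb_false_add_true (P := fun i y => R i y (x i))
      (fun i y => (hR i).1 _ _) (fun i => (hR i).2 _) φ
    have a0 := productProb_nonneg (P := fun i y => R i y (x i))
      (fun i y => (hR i).1 _ _) {y | φ y = false}
    have b0 := productProb_nonneg (P := fun i y => R i y (x i))
      (fun i y => (hR i).1 _ _) {y | φ y = true}
    have h2 := mul_le_mul_of_nonneg_right (min_le_left (∏ i, p (x i)) (∏ i, q (x i))) a0
    have h3 := mul_le_mul_of_nonneg_right (min_le_right (∏ i, p (x i)) (∏ i, q (x i))) b0
    calc _ = min (∏ i, p (x i)) (∏ i, q (x i)) * 1 := (mul_one _).symm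
      _ ≤ _ := by rw [← h1, mul_add]; exact add_le_add h2 h3
  -- Cauchy–Schwarz with `min * max = product` bounds the squared Bhattacharyya coefficient by `0.1
  -- * 2`.
  have hcs := Finset.sum_mul_sq_le_sq_mul_sq Finset.univ
    (fun x : Fin n → X => √(min (∏ i, p (x i)) (∏ i, q (x i))))
    (fun x : Fin n → X => √(max (∏ i, p (x i)) (∏ i, q (x i))))
  simp only [← Real.sqrt_mul (le_min (hp0 _) (hq0 _)), min_mul_max,
    Real.sq_sqrt (le_min (hp0 _) (hq0 _)),
    Real.sq_sqrt ((hp0 _).trans (le_max_left _ (∏ i, q (_ : X))))] at hcs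
  simp only [Real.sqrt_mul (hp0 _), sum_sqrt_prod_mul_sqrt_prod hp hq] at hcs
  have hmax : ∑ x : Fin n → X, max (∏ i, p (x i)) (∏ i, q (x i)) ≤ 2 := by
    calc _ ≤ ∑ x : Fin n → X, ((∏ i, p (x i)) + ∏ i, q (x i)) := by
          refine Finset.sum_le_sum fun x _ => ?_
          exact max_le_add_of_nonneg (hp0 x) (hq0 x)
      _ = 2 := by
          rw [Finset.sum_add_distrib, sum_prod_eq_one hp, sum_prod_eq_one hq]
          norm_num
  have hb := one_add_mul_le_pow (a := -(hellingerSq p q / 2))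
    (by linarith [hellingerSq_le_two hp hq]) n
  rw [← sub_eq_add_neg] at hb
  have hfin : ((1 - hellingerSq p q / 2) ^ n) ^ 2 ≤ 0.2 := by
    refine hcs.trans ((mul_le_mul hmin hmax (Finset.sum_nonneg fun x _ =>
      (hp0 x).trans (le_max_left _ _)) (by norm_num)).trans (by norm_num))
  -- If `n H² < 1`, Bernoulli's inequality makes the coefficient exceed `1/2`, and `1/4 > 0.2`.
  by_contra! hlt
  nlinarith

/-- Sufficiency: `5 / H²(Tp, Tq)` samples suffice with the channel `T`. -/
theorem solvableWith_singleton {X : Type} [Fintype X] [Fintype Y] {p q : X → ℝ} {T : Matrix Y X ℝ}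
    (hp : T *ᵥ p ∈ stdSimplex ℝ Y) (hq : T *ᵥ q ∈ stdSimplex ℝ Y)
    (h : 5 ≤ n * hellingerSq (T *ᵥ p) (T *ᵥ q)) : SolvableWith {T} p q n := by
  classical
  refine ⟨fun _ => T, fun _ => rfl,
    -- In the likelihood-ratio test each outcome contributes the smaller of its two masses, hence at
    -- most their geometric mean; the sum is at most `exp (-5/2) < 0.1`.
    fun y => decide (∏ i, (T *ᵥ q) (y i) ≤ ∏ i, (T *ᵥ p) (y i)), ?_⟩
  rw [productProb_of_fintype, productProb_of_fintype, ← Finset.sum_add_distrib]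
  have h1 : (1 - hellingerSq (T *ᵥ p) (T *ᵥ q) / 2) ^ n ≤ 0.1 := by
    have h2 : 1 - hellingerSq (T *ᵥ p) (T *ᵥ q) / 2 ≤
        Real.exp (-(hellingerSq (T *ᵥ p) (T *ᵥ q) / 2)) := by
      linarith [Real.add_one_le_exp (-(hellingerSq (T *ᵥ p) (T *ᵥ q) / 2))]
    refine (pow_le_pow_left₀ (by linarith [hellingerSq_le_two hp hq]) h2 n).trans ?_
    rw [← Real.exp_nat_mul]
    have h3 : Real.exp (n * -(hellingerSq (T *ᵥ p) (T *ᵥ q) / 2)) ≤ Real.exp (-(5 / 2)) :=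
      Real.exp_le_exp.2 (by linarith)
    refine h3.trans ?_
    rw [Real.exp_neg, show (0.1 : ℝ) = (10 : ℝ)⁻¹ by norm_num]
    apply inv_anti₀ (by norm_num)
    have e : Real.exp (5 / 2) ^ 2 = Real.exp 1 ^ 5 := by
      rw [← Real.exp_nat_mul, ← Real.exp_nat_mul]
      norm_num
    have h4 : (2.7 : ℝ) ^ 5 ≤ Real.exp 1 ^ 5 := by
      gcongr
      linarith [Real.exp_one_gt_d9]
    nlinarith [Real.exp_pos (5 / 2)]
  refine le_trans ?_ ((sum_sqrt_prod_mul_sqrt_prod hp hq n).le.trans h1)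
  refine Finset.sum_le_sum fun y _ => ?_
  have hP : 0 ≤ ∏ i, (T *ᵥ p) (y i) := Finset.prod_nonneg fun _ _ => hp.1 _
  have hQ : 0 ≤ ∏ i, (T *ᵥ q) (y i) := Finset.prod_nonneg fun _ _ => hq.1 _
  rcases le_or_gt (∏ i, (T *ᵥ q) (y i)) (∏ i, (T *ᵥ p) (y i)) with hle | hlt
  · simp only [Set.mem_ofPred_eq, hle, decide_true, reduceCtorEq, if_false, if_true, zero_add]
    nlinarith [Real.mul_self_sqrt hQ, Real.sqrt_le_sqrt hle, Real.sqrt_nonneg (∏ i, (T *ᵥ q) (y i))]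
  · simp only [Set.mem_ofPred_eq, not_le.2 hlt, decide_false, reduceCtorEq, if_false, if_true,
      add_zero]
    nlinarith [Real.mul_self_sqrt hP, Real.sqrt_le_sqrt hlt.le,
      Real.sqrt_nonneg (∏ i, (T *ᵥ p) (y i))]

end

/-! ### Relabelling of outputs and monotonicity of the sample complexity -/

theorem IsChannel.mulVec_mem_stdSimplex {X Y : Type} [Fintype X] [Fintype Y] {T : Matrix Y X ℝ}
    (hT : IsChannel T) {p : X → ℝ} (hp : p ∈ stdSimplex ℝ X) : T *ᵥ p ∈ stdSimplex ℝ Y := by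
  refine ⟨fun y => Finset.sum_nonneg fun x _ => mul_nonneg (hT.1 y x) (hp.1 x), ?_⟩
  simp only [Matrix.mulVec, dotProduct]
  rw [Finset.sum_comm]
  simp only [← Finset.sum_mul, ((hasSum_fintype _).unique (hT.2 _) : ∑ y, T y _ = 1), one_mul, hp.2]

/-- Relabelling outputs by an injection. -/
noncomputable def pushChannel {X Y Z : Type} (ι : Y → Z) (T : Matrix Y X ℝ) : Matrix Z X ℝ :=
  Matrix.of fun z x => Function.extend ι (fun y => T y x) 0 z

section

variable {X Y Z : Type} {ι : Y → Z} {T : Matrix Y X ℝ}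

theorem pushChannel_apply (hι : ι.Injective) (y : Y) (x : X) :
    pushChannel ι T (ι y) x = T y x :=
  hι.extend_apply (fun y => T y x) (0 : Z → ℝ) y

theorem pushChannel_apply_of_notMem {z : Z} (hz : z ∉ Set.range ι) (x : X) :
    pushChannel ι T z x = 0 :=
  Function.extend_apply' (fun y => T y x) (0 : Z → ℝ) z hz

theorem isChannel_pushChannel (hι : ι.Injective) (hT : IsChannel T) :
    IsChannel (pushChannel ι T) := by
  refine ⟨fun z x => ?_, fun x => ?_⟩
  · by_cases hz : z ∈ Set.range ι
    · obtain ⟨y, rfl⟩ := hz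
      rw [pushChannel_apply hι]
      exact hT.1 y x
    · rw [pushChannel_apply_of_notMem hz]
  · rw [← hι.hasSum_iff fun z hz => pushChannel_apply_of_notMem hz x]
    simpa only [Function.comp_def, pushChannel_apply hι] using hT.2 x

theorem isLDP_pushChannel {ε : ℝ} (hι : ι.Injective) (hT : IsLDP ε T) :
    IsLDP ε (pushChannel ι T) := by
  intro x x' z
  by_cases hz : z ∈ Set.range ι
  · obtain ⟨y, rfl⟩ := hz
    simpa only [pushChannel_apply hι] using hT x x' y
  · simp [pushChannel_apply_of_notMem hz]

/-- A tuple with some coordinate outside the range of `ι` has mass zero, so only relabelled tuples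
count. -/
theorem productProb_pushChannel [Fintype X] {n : ℕ} (hι : ι.Injective) (R : Fin n → Matrix Y X ℝ)
    (p : X → ℝ) (A : Set (Fin n → Z)) :
    productProb (fun i => pushChannel ι (R i) *ᵥ p) A =
      productProb (fun i => R i *ᵥ p) {y | (fun i => ι (y i)) ∈ A} := by
  have hinj : Function.Injective fun (y : Fin n → Y) i => ι (y i) := hι.comp_left
  rw [productProb, productProb, ← hinj.tsum_eq]
  · refine tsum_congr fun y => ?_
    by_cases hy : (fun i => ι (y i)) ∈ A
    · rw [Set.indicator_of_mem hy, Set.indicator_of_mem (by exact hy)]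
      simp only [Matrix.mulVec, dotProduct, pushChannel_apply hι]
    · rw [Set.indicator_of_notMem hy, Set.indicator_of_notMem (by exact hy)]
  · intro z hz
    by_contra hzr
    obtain ⟨i, hi⟩ : ∃ i, z i ∉ Set.range ι := by
      by_contra! hall
      choose y hy using hall
      exact hzr ⟨y, funext hy⟩
    refine hz (Set.indicator_apply_eq_zero.2 fun _ => Finset.prod_eq_zero (Finset.mem_univ i) ?_)
    simp [Matrix.mulVec, dotProduct, pushChannel_apply_of_notMem hi]

/-- The test undoes the relabelling by a left inverse of `ι`. This moves channels with finite output
into `ℕ` and into larger alphabets. -/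
theorem SolvableWith.push [Fintype X] [Nonempty Y] {n : ℕ} {p q : X → ℝ} {𝒞 : Set (Matrix Y X ℝ)}
    {𝒟 : Set (Matrix Z X ℝ)} (hι : ι.Injective) (h𝒞 : ∀ T ∈ 𝒞, pushChannel ι T ∈ 𝒟)
    (h : SolvableWith 𝒞 p q n) : SolvableWith 𝒟 p q n := by
  obtain ⟨R, hR, φ, herr⟩ := h
  refine ⟨fun i => pushChannel ι (R i), fun i => h𝒞 _ (hR i),
    fun z => φ fun i => Function.invFun ι (z i), ?_⟩
  rw [productProb_pushChannel hι, productProb_pushChannel hι]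
  simpa only [Set.mem_ofPred_eq, Function.leftInverse_invFun hι _] using herr

end

theorem sampleComplexity_le {X Y : Type} [Fintype X] {𝒞 : Set (Matrix Y X ℝ)} {p q : X → ℝ} {n : ℕ}
    (h : SolvableWith 𝒞 p q n) : sampleComplexity 𝒞 p q ≤ n :=
  sInf_le ⟨n, h, rfl⟩

theorem sampleComplexity_mono {X Y Z : Type} [Fintype X] {𝒞 : Set (Matrix Y X ℝ)}
    {𝒟 : Set (Matrix Z X ℝ)} {p q : X → ℝ}
    (h : ∀ n, SolvableWith 𝒞 p q n → SolvableWith 𝒟 p q n) :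
    sampleComplexity 𝒟 p q ≤ sampleComplexity 𝒞 p q :=
  sInf_le_sInf (Set.image_mono fun n hn => h n hn)

theorem SolvableWith.mono {X Y : Type} [Fintype X] {𝒞 𝒟 : Set (Matrix Y X ℝ)} {p q : X → ℝ} {n : ℕ}
    (h𝒞 : 𝒞 ⊆ 𝒟) (h : SolvableWith 𝒞 p q n) : SolvableWith 𝒟 p q n := by
  obtain ⟨R, hR, h⟩ := h
  exact ⟨R, fun i => h𝒞 (hR i), h⟩

theorem solvableWith_toNat {X Y : Type} [Fintype X] {𝒞 : Set (Matrix Y X ℝ)} {p q : X → ℝ}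
    (h : sampleComplexity 𝒞 p q ≠ ⊤) :
    SolvableWith 𝒞 p q (sampleComplexity 𝒞 p q).toNat := by
  have hne : ((fun n : ℕ => (n : ℕ∞)) '' {n | SolvableWith 𝒞 p q n}).Nonempty := by
    by_contra hemp
    rw [Set.not_nonempty_iff_eq_empty] at hemp
    exact h (by rw [sampleComplexity, hemp, sInf_empty])
  obtain ⟨n, hn, he⟩ := csInf_mem hne
  have : sampleComplexity 𝒞 p q = n := he.symm
  rw [this]
  exact hn

/-! ## The privatized quantizer -/

theorem two_le_of_ne {k : ℕ} {p q : Fin k → ℝ} (hp : p ∈ stdSimplex ℝ (Fin k))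
    (hq : q ∈ stdSimplex ℝ (Fin k)) (hpq : p ≠ q) : 2 ≤ k := by
  by_contra! hk
  have : Subsingleton (Fin k) := Fin.subsingleton_iff_le_one.2 (by omega)
  obtain ⟨x, hx⟩ := Function.ne_iff.1 hpq
  have : Unique (Fin k) := uniqueOfSubsingleton x
  have h1 := hp.2
  have h2 := hq.2
  rw [Fintype.sum_unique, Subsingleton.elim default x] at h1 h2
  exact hx (h1.trans h2.symm)

/-- The program computes a quantizer that preserves the Hellinger divergence up to a constant,
followed by randomized response. -/
theorem QuantProgram.outputs_quantizer {k : ℕ} {p q : Fin k → ℝ} (hp : p ∈ stdSimplex ℝ (Fin k))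
    (hq : q ∈ stdSimplex ℝ (Fin k)) (hpq : p ≠ q) (ε : ℝ) :
    ∃ (Q : Fin k → Fin (quantSize p q)) (t : ℕ),
      hellingerSq p q ≤ 8 * Real.exp 8 * hellingerSq (detChannel Q *ᵥ p) (detChannel Q *ᵥ q) ∧
      RAMOutputs prog p q ε t (randResponse ε (quantSize p q) * detChannel Q) ∧
      t ≤ 30 * k ^ 2 := by
  have hk := two_le_of_ne hp hq hpq
  obtain ⟨σ, Q, t, hσ, hQ, hout, ht⟩ := outputs hk p q ε
  refine ⟨Q, t, ?_, hout, ht⟩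
  by_cases hm : quantSize p q < k
  · have hbin (x : Fin k) : IsBin σ (quantSize p q) (p x) (q x) (Q x) :=
      ((hQ x).resolve_right fun h => h.1 hm).2
    refine hellingerSq_le_of_bins (σ := σ) hp hq hpq (le_max_left _ _) ?_ ?_ ?_ Q
      (fun x => (hbin x).2.1) fun x => (hbin x).2.2
    · refine (Nat.le_ceil _).trans ?_
      have h : ⌈Real.log (1 / hellingerSq p q)⌉₊ ≤ quantSize p q := by
        unfold quantSize at hm ⊢
        omega
      exact_mod_cast h
    · rw [hσ]
      split_ifs <;> simp
    · rw [hσ]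
      split_ifs with h
      · linarith
      · linarith
  · have hQx (x : Fin k) : (Q x : ℕ) = x := ((hQ x).resolve_left fun h => hm h.1).2
    have hmk : quantSize p q = k := le_antisymm (max_le hk (min_le_right _ _)) (not_lt.1 hm)
    have hinj : Function.Injective Q := fun x y h => Fin.ext (by rw [← hQx x, ← hQx y, h])
    have hbij : Function.Bijective Q :=
      (Fintype.bijective_iff_injective_and_card Q).2 ⟨hinj, by simp [hmk]⟩
    have hval (f : Fin k → ℝ) (x : Fin k) : (detChannel Q *ᵥ f) (Q x) = f x := by
      rw [detChannel_mulVec, Finset.sum_eq_single x]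
      · intro y hy hne
        exact absurd (hinj (Finset.mem_filter.1 hy).2) hne
      · intro h
        simp at h
    have heq : hellingerSq (detChannel Q *ᵥ p) (detChannel Q *ᵥ q) = hellingerSq p q := by
      rw [hellingerSq, ← hbij.sum_comp]
      simp only [hval]
      rfl
    rw [heq]
    have : 1 ≤ Real.exp 8 := Real.one_le_exp (by norm_num)
    nlinarith [hellingerSq_nonneg p q]

/-- Since `L ≥ 1`, a factor 2 absorbs both the rounding and the minimal size `2`. -/
theorem quantSize_le_two_mul_logInvHellinger {k : ℕ} (p q : Fin k → ℝ) :
    (quantSize p q : ℝ) ≤ 2 * logInvHellinger p q := by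
  have h1 : 1 ≤ logInvHellinger p q := le_max_left _ _
  have h2 : Real.log (1 / hellingerSq p q) ≤ logInvHellinger p q := le_max_right _ _
  rw [quantSize, Nat.cast_max, Nat.cast_min]
  refine max_le (by push_cast; linarith) ((min_le_left _ _).trans ?_)
  rcases le_or_gt 0 (Real.log (1 / hellingerSq p q)) with h | h
  · linarith [Nat.ceil_lt_add_one h]
  · rw [Nat.ceil_eq_zero.2 h.le]
    push_cast
    linarith

theorem min_one_le_mul_min_one {a b K : ℝ} (hK : 1 ≤ K) (ha : a ≤ K * b) :
    min 1 a ≤ K * min 1 b := by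
  rcases le_total 1 b with h | h
  · rw [min_eq_left h]
    linarith [min_le_left 1 a]
  · rw [min_eq_right h]
    linarith [min_le_right 1 a]

/-- Randomized response after a good quantizer. -/
theorem hellingerSq_randResponse_quantizer {k : ℕ} {p q : Fin k → ℝ}
    (hp : p ∈ stdSimplex ℝ (Fin k)) (hq : q ∈ stdSimplex ℝ (Fin k)) {ε : ℝ} (hε : 1 < ε) {K : ℝ}
    (hK : 1 ≤ K) (Q : Fin k → Fin (quantSize p q))
    (h : hellingerSq p q ≤ K * hellingerSq (detChannel Q *ᵥ p) (detChannel Q *ᵥ q)) :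
    hellingerSq p q * min 1 (Real.exp ε * hellingerSq p q / logInvHellinger p q)
        * min 1 (Real.exp ε / logInvHellinger p q) ≤
      768 * K ^ 2 * hellingerSq ((randResponse ε (quantSize p q) * detChannel Q) *ᵥ p)
        ((randResponse ε (quantSize p q) * detChannel Q) *ᵥ q) := by
  have hm : 2 ≤ quantSize p q := le_max_left _ _
  have hm' : (0 : ℝ) < quantSize p q := by exact_mod_cast (by omega)
  have hL : 1 ≤ logInvHellinger p q := le_max_left _ _
  have hmL := quantSize_le_two_mul_logInvHellinger p q
  have hRR := hellingerSq_randResponse hε hm (detChannel_mulVec_mem_stdSimplex Q hp)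
    (detChannel_mulVec_mem_stdSimplex Q hq)
  rw [Matrix.mulVec_mulVec, Matrix.mulVec_mulVec] at hRR
  have hH := hellingerSq_nonneg p q
  have hg := hellingerSq_nonneg (detChannel Q *ᵥ p) (detChannel Q *ᵥ q)
  set g := hellingerSq (detChannel Q *ᵥ p) (detChannel Q *ᵥ q)
  set H := hellingerSq p q
  set L := logInvHellinger p q
  set E := Real.exp ε
  have hE : 0 < E := Real.exp_pos ε
  have hLm : 1 / L ≤ 2 / (quantSize p q : ℝ) := by
    rw [div_le_div_iff₀ (by linarith) hm']
    linarith
  have f1 : min 1 (E / L) ≤ 2 * min 1 (E / (quantSize p q : ℝ)) := by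
    refine min_one_le_mul_min_one (by norm_num) ?_
    have := mul_le_mul_of_nonneg_left hLm hE.le
    calc E / L = E * (1 / L) := by ring
      _ ≤ _ := this
      _ = _ := by ring
  have f2 : min 1 (E * H / L) ≤ 2 * K * min 1 (E * g / (quantSize p q : ℝ)) := by
    refine min_one_le_mul_min_one (by linarith) ?_
    calc E * H / L = E * (H * (1 / L)) := by ring
      _ ≤ E * ((K * g) * (2 / (quantSize p q : ℝ))) := by gcongr
      _ = _ := by ring
  calc H * min 1 (E * H / L) * min 1 (E / L)
      ≤ (K * g) * (2 * K * min 1 (E * g / (quantSize p q : ℝ))) *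
          (2 * min 1 (E / (quantSize p q : ℝ))) := by gcongr
    _ = 4 * K ^ 2 * (g * min 1 (E * g / (quantSize p q : ℝ)) *
          min 1 (E / (quantSize p q : ℝ))) := by ring
    _ ≤ 4 * K ^ 2 * (192 * _) := by gcongr
    _ = _ := by ring

/-- In the low-privacy regime the factors lost to privacy are bounded below. -/
theorem le_min_mul_min_of_low_privacy {k : ℕ} {p q : Fin k → ℝ} (hp : p ∈ stdSimplex ℝ (Fin k))
    (hq : q ∈ stdSimplex ℝ (Fin k)) (hpq : p ≠ q) {ε c : ℝ} (hε : 1 < ε) (hc : 0 < c)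
    (h : c * (1 / hellingerSq p q * Real.log (1 / hellingerSq p q)) ≤ Real.exp ε) :
    min 1 c * (min 1 c / 2) ≤ min 1 (Real.exp ε * hellingerSq p q / logInvHellinger p q) *
      min 1 (Real.exp ε / logInvHellinger p q) := by
  have hH := hellingerSq_pos hp hq hpq
  have hH2 := hellingerSq_le_two hp hq
  set H := hellingerSq p q
  have key : min 1 c ≤ Real.exp ε * H / logInvHellinger p q := by
    -- If the logarithm is at least `1`, this is the hypothesis multiplied by `H`. Otherwise `H ≥
    -- exp (-1)`, and `ε > 1` alone gives `exp ε * H ≥ 1`.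
    rcases le_total 1 (Real.log (1 / H)) with hl | hl
    · have e : logInvHellinger p q = Real.log (1 / H) := max_eq_right hl
      rw [e, le_div_iff₀ (by linarith)]
      have h1 := mul_le_mul_of_nonneg_right h hH.le
      have h2 : c * (1 / H * Real.log (1 / H)) * H = c * Real.log (1 / H) := by
        field_simp
      rw [h2] at h1
      exact (mul_le_mul_of_nonneg_right (min_le_right 1 c) (by linarith)).trans h1
    · have e : logInvHellinger p q = 1 := max_eq_left hl
      rw [e, div_one]
      refine (min_le_left _ _).trans ?_
      rw [one_div, Real.log_inv] at hl
      have h1 : Real.exp (-1) ≤ H := by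
        rw [← Real.exp_log hH]
        exact Real.exp_le_exp.2 (by linarith)
      calc (1 : ℝ) = Real.exp 1 * Real.exp (-1) := by rw [← Real.exp_add]; norm_num
        _ ≤ Real.exp ε * H := by gcongr
  have hL : 1 ≤ logInvHellinger p q := le_max_left _ _
  have hX : 0 ≤ Real.exp ε / logInvHellinger p q := by positivity
  refine mul_le_mul (le_min (min_le_left _ _) key) (le_min (by linarith [min_le_left 1 c]) ?_)
    (by positivity) (by positivity)
  -- As `H ≤ 2`, the second factor is controlled by the first, up to the halving in the statement.
  have h2 : Real.exp ε * H / logInvHellinger p q ≤ 2 * (Real.exp ε / logInvHellinger p q) := by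
    rw [mul_div_right_comm]
    nlinarith
  linarith

/-! ### From Hellinger bounds to sample complexity, and the theorem -/

theorem pushChannel_eq_detChannel_mul {X Y Z : Type} [Fintype Y] [DecidableEq Z] {ι : Y → Z}
    (hι : ι.Injective) (T : Matrix Y X ℝ) : pushChannel ι T = detChannel ι * T := by
  ext z x
  rw [Matrix.mul_apply]
  by_cases hz : z ∈ Set.range ι
  · obtain ⟨y, rfl⟩ := hz
    rw [pushChannel_apply hι, Finset.sum_eq_single y]
    · simp [detChannel]
    · intro y' _ hne
      simp [detChannel, hι.ne hne]
    · simp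
  · rw [pushChannel_apply_of_notMem hz, Finset.sum_eq_zero]
    intro y _
    have : ι y ≠ z := fun h => hz ⟨y, h⟩
    simp [detChannel, this]

/-- A channel that preserves the Hellinger divergence up to a factor attains the sample complexity
up to a factor. -/
theorem sampleComplexity_singleton_le {X Y Z : Type} [Fintype X] [Fintype Y] [Nonempty Y]
    {p q : X → ℝ} (hp : p ∈ stdSimplex ℝ X) (hq : q ∈ stdSimplex ℝ X)
    {T : Matrix Y X ℝ} (hT : IsChannel T) {𝒞 : Set (Matrix Z X ℝ)} (h𝒞 : ∀ T ∈ 𝒞, IsChannel T)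
    (htop : sampleComplexity 𝒞 p q ≠ ⊤) {A : ℝ}
    (h : hellingerSq p q ≤ A * hellingerSq (T *ᵥ p) (T *ᵥ q)) {C : ℕ} (hC : 5 * A + 1 ≤ C) :
    SolvableWith {T} p q (C * (sampleComplexity 𝒞 p q).toNat) := by
  -- With `N` the unconstrained-by-`T` optimum over `𝒞`, the chain is `5 ≤ 5 N H² ≤ 5 A N H²(Tp, Tq)
  -- ≤ C N H²(Tp, Tq)`.
  have hn := one_le_mul_hellingerSq hp hq h𝒞 (solvableWith_toNat htop)
  refine solvableWith_singleton (hT.mulVec_mem_stdSimplex hp) (hT.mulVec_mem_stdSimplex hq) ?_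
  set N : ℝ := ((sampleComplexity 𝒞 p q).toNat : ℝ) with hN
  have hN0 : 0 ≤ N := Nat.cast_nonneg _
  have hHT := hellingerSq_nonneg (T *ᵥ p) (T *ᵥ q)
  push_cast
  rw [← hN]
  have h1 := mul_le_mul_of_nonneg_left h hN0
  have h2 := mul_le_mul_of_nonneg_right hC (mul_nonneg hN0 hHT)
  nlinarith [mul_nonneg hN0 hHT]

theorem mainTheorem5 :
    (∃ (prog : RAMProgram) (a : ℝ) (d : ℕ), ∀ c : ℝ, 0 < c → ∃ C : ℕ,
      ∀ (k : ℕ) (p q : Fin k → ℝ), p ∈ stdSimplex ℝ (Fin k) → q ∈ stdSimplex ℝ (Fin k) → p ≠ q →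
      ∀ ε : ℝ, 1 < ε →
        c * (1 / hellingerSq p q * Real.log (1 / hellingerSq p q)) ≤ Real.exp ε →
        nStar p q ≠ ⊤ ∧ nStar p q ≤ nStarLDP p q ε ∧ nStarLDP p q ε ≤ C * nStar p q ∧
        ∃ (m : ℕ) (_ : 2 ≤ m) (hm : m ≤ freeSize p q) (Q : Fin k → Fin m)
          (T : Matrix (Fin (freeSize p q)) (Fin k) ℝ),
          T = detChannel (Fin.castLE hm) * (randResponse ε m * detChannel Q) ∧
          hellingerSq p q ≤ C * hellingerSq (detChannel Q *ᵥ p) (detChannel Q *ᵥ q) ∧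
          IsChannel T ∧ IsLDP ε T ∧
          nStarLDP p q ε ≤ sampleComplexity {T} p q ∧
          sampleComplexity {T} p q ≤ C * nStar p q ∧
          ∃ t : ℕ, RAMOutputs prog p q ε t (randResponse ε m * detChannel Q) ∧
            (t : ℝ) ≤ a * (k + Real.log ((nStar p q).toNat : ℝ)) ^ d) ∧
    (∃ (prog : RAMProgram) (a : ℝ) (d : ℕ) (c : ℝ), 0 < c ∧
      ∀ (k : ℕ) (p q : Fin k → ℝ), p ∈ stdSimplex ℝ (Fin k) → q ∈ stdSimplex ℝ (Fin k) → p ≠ q →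
      ∀ ε : ℝ, 1 < ε →
        ∃ T : Matrix (Fin (quantSize p q)) (Fin k) ℝ,
          IsChannel T ∧ IsLDP ε T ∧
          c * (hellingerSq p q
              * min 1 (Real.exp ε * hellingerSq p q / logInvHellinger p q)
              * min 1 (Real.exp ε / logInvHellinger p q))
            ≤ hellingerSq (T *ᵥ p) (T *ᵥ q) ∧
          ∃ t : ℕ, RAMOutputs prog p q ε t T ∧ (t : ℝ) ≤ a * (k + quantSize p q) ^ d) := by
  obtain ⟨K, hK, hK1⟩ : ∃ K : ℝ, K = 8 * Real.exp 8 ∧ 1 ≤ K :=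
    ⟨_, rfl, by linarith [Real.one_le_exp (show (0 : ℝ) ≤ 8 by norm_num)]⟩
  refine ⟨⟨QuantProgram.prog, 30, 2, fun c hc => ?_⟩,
    QuantProgram.prog, 30, 2, (768 * K ^ 2)⁻¹, by positivity, ?_⟩
  · set A : ℝ := 768 * K ^ 2 / (min 1 c * (min 1 c / 2)) with hA
    have hκ : 0 < min 1 c * (min 1 c / 2) := by positivity
    -- One constant for two purposes: `K` for the quantizer, `5 * A + 1` for the sample complexity.
    refine ⟨⌈K⌉₊ + ⌈5 * A + 1⌉₊, fun k p q hp hq hpq ε hε hc' => ?_⟩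
    set C : ℕ := ⌈K⌉₊ + ⌈5 * A + 1⌉₊ with hC
    have hCK : K ≤ C := by
      rw [hC]
      push_cast
      linarith [Nat.le_ceil K, (Nat.cast_nonneg ⌈5 * A + 1⌉₊ : (0 : ℝ) ≤ _)]
    have hCA : 5 * A + 1 ≤ C := by
      rw [hC]
      push_cast
      linarith [Nat.le_ceil (5 * A + 1), (Nat.cast_nonneg ⌈K⌉₊ : (0 : ℝ) ≤ _)]
    obtain ⟨Q, t, hQ, hout, ht⟩ := QuantProgram.outputs_quantizer hp hq hpq ε
    rw [← hK] at hQ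
    have hH := hellingerSq_pos hp hq hpq
    have hm2 : 2 ≤ quantSize p q := le_max_left _ _
    have : Nonempty (Fin (quantSize p q)) := ⟨⟨0, by omega⟩⟩
    set S := randResponse ε (quantSize p q) * detChannel Q with hS
    have hSc : IsChannel S := isChannel_mul_detChannel (isChannel_randResponse (by omega)) Q
    have hSl : IsLDP ε S := isLDP_mul_detChannel (isLDP_randResponse (by linarith)) Q
    have hST : hellingerSq p q ≤ A * hellingerSq (S *ᵥ p) (S *ᵥ q) := by
      have h1 := hellingerSq_randResponse_quantizer hp hq hε hK1 Q hQ
      have h2 := le_min_mul_min_of_low_privacy hp hq hpq hε hc hc'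
      rw [hA, div_mul_eq_mul_div, le_div_iff₀ hκ]
      rw [mul_assoc] at h1
      exact (mul_le_mul_of_nonneg_left h2 hH.le).trans h1
    have hST0 : 0 < hellingerSq (S *ᵥ p) (S *ᵥ q) := by
      have hA0 : 0 < A := by positivity
      exact pos_of_mul_pos_right (hH.trans_le hST) hA0.le
    have hsolv : ∃ n, SolvableWith {S} p q n := by
      obtain ⟨n, hn⟩ := exists_nat_ge (5 / hellingerSq (S *ᵥ p) (S *ᵥ q))
      exact ⟨n, solvableWith_singleton (hSc.mulVec_mem_stdSimplex hp)
        (hSc.mulVec_mem_stdSimplex hq) ((div_le_iff₀ hST0).1 hn)⟩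
    have hle : nStar p q ≤ nStarLDP p q ε :=
      sampleComplexity_mono fun n => SolvableWith.mono fun T hT => hT.1
    have hpush {ℓ : ℕ} [Nonempty (Fin ℓ)] {T : Matrix (Fin ℓ) (Fin k) ℝ} (hT : IsChannel T)
        (hTl : IsLDP ε T) : nStarLDP p q ε ≤ sampleComplexity {T} p q := by
      refine sampleComplexity_mono fun n => SolvableWith.push Fin.val_injective ?_
      rintro _ rfl
      exact ⟨isChannel_pushChannel Fin.val_injective hT, isLDP_pushChannel Fin.val_injective hTl⟩
    -- Finiteness comes from the private channel itself, whose output laws have positive divergence.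
    have htop : nStar p q ≠ ⊤ := by
      obtain ⟨n, hn⟩ := hsolv
      exact ne_top_of_le_ne_top (ENat.natCast_ne_top n)
        (hle.trans ((hpush hSc hSl).trans (sampleComplexity_le hn)))
    -- The program knows `H²` but not `n*`; its output still fits because `1 / H² ≤ n*`.
    have hsize : quantSize p q ≤ freeSize p q := by
      refine max_le_max le_rfl ((min_le_left _ _).trans (Nat.ceil_le_ceil ?_))
      refine Real.log_le_log (by positivity) ?_
      rw [div_le_iff₀ hH]
      exact one_le_mul_hellingerSq hp hq (fun _ => id) (solvableWith_toNat htop)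
    have : Nonempty (Fin (freeSize p q)) := ⟨⟨0, by omega⟩⟩
    have hinj := Fin.castLE_injective hsize
    have hTS := pushChannel_eq_detChannel_mul hinj S
    set T := detChannel (Fin.castLE hsize) * S
    have hTc : IsChannel T := hTS ▸ isChannel_pushChannel hinj hSc
    have hTl : IsLDP ε T := hTS ▸ isLDP_pushChannel hinj hSl
    have hup : sampleComplexity {T} p q ≤ C * nStar p q := by
      -- Enlarging the output alphabet does not change the number of users, so the bound for `S`
      -- passes to `T`.
      have h1 := sampleComplexity_singleton_le hp hq hSc (fun _ => id) htop hST hCA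
      have h2 : SolvableWith {T} p q _ := SolvableWith.push hinj (by rintro _ rfl; exact hTS) h1
      refine (sampleComplexity_le h2).trans ?_
      rw [Nat.cast_mul]
      exact mul_le_mul_right (ENat.natCast_toNat htop).le _
    refine ⟨htop, hle, (hpush hTc hTl).trans hup, quantSize p q, hm2, hsize, Q, T, rfl,
      hQ.trans (mul_le_mul_of_nonneg_right hCK (hellingerSq_nonneg _ _)), hTc, hTl,
      hpush hTc hTl, hup, t, hout, ?_⟩
    have hlog : 0 ≤ Real.log ((nStar p q).toNat : ℝ) := Real.log_natCast_nonneg _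
    calc (t : ℝ) ≤ 30 * (k : ℝ) ^ 2 := by exact_mod_cast ht
      _ ≤ _ := by gcongr; linarith
  · intro k p q hp hq hpq ε hε
    obtain ⟨Q, t, hQ, hout, ht⟩ := QuantProgram.outputs_quantizer hp hq hpq ε
    rw [← hK] at hQ
    have hm2 : 2 ≤ quantSize p q := le_max_left _ _
    refine ⟨_, isChannel_mul_detChannel (isChannel_randResponse (by omega)) Q,
      isLDP_mul_detChannel (isLDP_randResponse (by linarith)) Q, ?_, t, hout, ?_⟩
    · rw [inv_mul_le_iff₀ (by positivity)]
      exact hellingerSq_randResponse_quantizer hp hq hε hK1 Q hQ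
    · calc (t : ℝ) ≤ 30 * (k : ℝ) ^ 2 := by exact_mod_cast ht
        _ ≤ _ := by gcongr; linarith [(Nat.cast_nonneg (quantSize p q) : (0 : ℝ) ≤ _)]
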